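/- **Setting.** Let $T=[0,\infty)$, let $Q$ be a finite set (of modes), and let $m,p\in\mathbb N$. $Q^*$ is the set of finite words over $Q$, $\epsilon$ the empty word, $Q^{\le L}$ the set of words of length at most $L$. $PC(T,\mathbb R^m)$ is the set of functions $u:T\to\mathbb R^m$ with finitely many discontinuities on each $[0,t]$ and finite one-sided limits at each of them. An input-output map is a map $f: PC(T,\mathbb R^m)\times (Q\times T)^+\to\mathbb R^p$, where $(Q\times T)^+$ is the set of non-empty finite sequences $(q_1,t_1)\cdots(q_k,t_k)$. Let $\Phi$ be a (possibly infinite) set of input-output maps which has a *generalized kernel representation*: there are analytic functions $K^{f}_w:T^{|w|}\to\mathbb R^p$ and $G_w:T^{|w|}\to\mathbb R^{p\times m}$ ($f\in\Phi$, $w\in Q^*\setminus\{\epsilon\}$) such that * $K^f_{wqqv}(\ldots,t,\hat t,\ldots)=K^f_{wqv}(\ldots,t+\hat t,\ldots)$ and $G_{wqqv}(\ldots,t,\hat t,\ldots)=G_{wqv}(\ldots,t+\hat t,\ldots)$ for $w,v\in Q^*$, $q\in Q$; * $K^f_{vqw}(\ldots,0,\ldots)=K^f_{vw}(\ldots)$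 if $w\ne\epsilon$ and $G_{vqw}(\ldots,0,\ldots)=G_{vw}(\ldots)$ if $v,w\neq\epsilon$, where the $0$ is the time of $q$; * $f(u,(q_1,t_1)\cdots(q_k,t_k))=K^f_{q_1\cdots q_k}(t_1,\ldots,t_k)+\sum_{i=1}^k\int_0^{t_i}G_{q_i\cdots q_k}(t_i-s,t_{i+1},\ldots,t_k)\,u\bigl(s+\sum_{j<i}t_j\bigr)\,ds$ for all $f\in\Phi$, all $u$ and all switching sequences. **Systems.** A linear switched system (LSS) $\Sigma$ of dimension $n\ge 0$ consists of matrices $A_q\in\mathbb R^{n\times n}$, $B_q\in\mathbb R^{n\times m}$, $C_q\in\mathbb R^{p\times n}$, $q\in Q$. For $x_0\in\mathbb R^n$, $u$, and $w=(q_1,t_1)\cdots(q_k,t_k)$, its output is $y_\Sigma(x_0,u,w)=C_{q_k}x$, where $x$ is the state reached from $x_0$ by solving successively $\dot x=A_{q_i}x+B_{q_i}u$ for time $t_i$, $i=1,\ldots,k$. An LSS realization is a pair $(\Sigma,\mu)$ with $\mu:\Phi\to\mathbb R^n$. It is a realization of $\Phi$ if $y_\Sigma(\mu(f),u,w)=f(u,w)$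 for all $f\in\Phi$, $u$, $w$, and a minimal one if moreover no realization of $\Phi$ has smaller dimension. Two LSS realizations are isomorphic if an invertible linear map between the state spaces carries the matrices $A_q,B_q,C_q$ and $\mu$ of one to those of the other. **Markov parameters.** For $w=q_1\cdots q_k\in Q^*$, $q,q_0\in Q$, $j\in\{1,\ldots,m\}$, $f\in\Phi$ put $$S_{f,q}(w)=\tfrac{d}{dt_1}\cdots\tfrac{d}{dt_k}f\bigl(0,(q_1,t_1)\cdots(q_k,t_k)(q,0)\bigr)\big|_{t=0},$$ $$S_{q,q_0,j}(w)=\tfrac{d}{dt_0}\cdots\tfrac{d}{dt_k}\Bigl[f\bigl(e_j,(q_0,t_0)\cdots(q_k,t_k)(q,0)\bigr)-f\bigl(0,(q_0,t_0)\cdots(q_k,t_k)(q,0)\bigr)\Bigr]\Big|_{t=0},$$ where $e_j$ and $0$ denote constant inputs; the second does not depend on the choice of $f\in\Phi$ (and is taken to be $0$ if $\Phi=\emptyset$). $(\Sigma,\mu)$ is an *$M$-partial realization* of $\Phi$ if $S_{q,q_0,j}(w)=C_qA_{q_k}\cdots A_{q_1}B_{q_0}e_j$ and $S_{f,q}(w)=C_qA_{q_k}\cdots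 A_{q_1}\mu(f)$ for all $q,q_0,j,f$ and all words $w=q_1\cdots q_k$ with $k\le M$; it is a minimal one if moreover no $M$-partial realization has smaller dimension. **Hankel matrices.** Let $J_\Phi=\Phi\sqcup(Q\times\{1,\ldots,m\})$. The Hankel matrix $H_\Phi$ has rows indexed by $(v,(q,i))$ with $v\in Q^*$, $q\in Q$, $1\le i\le p$, columns indexed by $(w,j)\in Q^*\times J_\Phi$, and the entry there is the $i$th coordinate of $S_{f,q}(wv)$ if $j=f\in\Phi$ and of $S_{q,q_0,z}(wv)$ if $j=(q_0,z)$. $H_{\Phi,L,M}$ is the submatrix with $v\in Q^{\le L}$, $w\in Q^{\le M}$. The rank, in $\mathbb N\cup\{\infty\}$, is the dimension of the span of the columns. **Algorithm 1.** Choose a linear isomorphism $S$ from the column space of $H_{\Phi,N,N+1}$ to $\mathbb R^n$, $n=\operatorname{rank}H_{\Phi,N,N+1}$; let $\mathbf C_{w,j}$ be the column of $H_{\Phi,N,N+1}$ indexed by $(w,j)$. Return the $(\Sigma_N,\mu_N)$ of dimension $n$ such that the $j$th column of $B_q$ is $S(\mathbf C_{\epsilon,(q,j)})$, $\mu_N(f)=S(\mathbf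 C_{\epsilon,f})$, $C_qS(\mathbf C_{w,j})=\bigl((\mathbf C_{w,j})_{(\epsilon,(q,i))}\bigr)_{i=1}^p$ for $w\in Q^{\le N+1}$, $j\in J_\Phi$, and $S^{-1}A_qS(\mathbf C_{w,j})=\mathbf C_{wq,j}$ for $w\in Q^{\le N}$, $j\in J_\Phi$; abort if there is no such $A_q$. **Algorithm 2.** Choose a factorization $H_{\Phi,N+1,N}=OR$ with $O$ having $r$ columns, $R$ having $r$ rows and $r=\operatorname{rank}O=\operatorname{rank}R=\operatorname{rank}H_{\Phi,N+1,N}$. The $i$th row of $\widetilde C_q$ is the row $(\epsilon,(q,i))$ of $O$; the $j$th column of $\widetilde B_q$ is the column $(\epsilon,(q,j))$ of $R$; $\widetilde\mu_N(f)$ is the column $(\epsilon,f)$ of $R$. Let $\bar\Gamma$ be the submatrix of $O$ of the rows indexed by words in $Q^{\le N}$, and let $\bar\Gamma_q$ have as its row $(v,i)$, $v\in Q^{\le N}$, the row $(qv,i)$ of $O$. If for every $q\in Q$ the equation $\bar\Gamma\widetilde A_q=\bar\Gamma_q$ has a unique solution $\widetilde A_q\in\mathbb R^{r\times r}$, return $(\widetilde\Sigma_N,\widetilde\mu_N)$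 with $\widetilde\Sigma_N=(\widetilde A_q,\widetilde B_q,\widetilde C_q)_{q\in Q}$; otherwise return "NoRealization". **Theorem.** Let $N>0$. A factorization as required in Algorithm 2 and an isomorphism as required in Algorithm 1 exist, and the following hold. 1. Assume $$\operatorname{rank}H_{\Phi,N,N}=\operatorname{rank}H_{\Phi,N+1,N}=\operatorname{rank}H_{\Phi,N,N+1}.\qquad(*)$$ Then Algorithm 2, for every choice of the factorization, returns an LSS realization $(\widetilde\Sigma_N,\widetilde\mu_N)$, and this is a minimal $(2N+1)$-partial realization of $\Phi$. Moreover Algorithm 1, for every choice of the isomorphism, returns an LSS realization $(\Sigma_N,\mu_N)$, and $(\widetilde\Sigma_N,\widetilde\mu_N)$ is isomorphic to it. 2. If $\operatorname{rank}H_{\Phi,N,N}=\operatorname{rank}H_\Phi$, then $(*)$ holds and Algorithm 2, for every choice of the factorization, returns a minimal realization of $\Phi$. If there is a realization $(\Sigma,\mu)$ of $\Phi$ with $\dim\Sigma\le N+1$, then $\operatorname{rank}H_{\Phi,N,N}=\operatorname{rank}H_\Phi$ and Algorithm 2 returns a minimal realization of $\Phi$. -/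

import Mathlib

open Set Filter Topology
open scoped NNReal Matrix

namespace LinSwitch

/-! ### Inputs, switching sequences and input-output maps; the time axis is `ℝ≥0` -/

/-- Finitely many discontinuities on each `[0, T]`, with finite one-sided limits at each of them
(at `0` the filter `𝓝[<] 0` on `ℝ≥0` is trivial, so only the right limit is required there). -/
def IsPiecewiseContinuous {m : ℕ} (u : ℝ≥0 → (Fin m → ℝ)) : Prop :=
  (∀ T : ℝ≥0, {t : ℝ≥0 | t ≤ T ∧ ¬ ContinuousAt u t}.Finite) ∧
  ∀ t : ℝ≥0, ¬ ContinuousAt u t →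
    (∃ l : Fin m → ℝ, Tendsto u (𝓝[<] t) (𝓝 l)) ∧ (∃ l : Fin m → ℝ, Tendsto u (𝓝[>] t) (𝓝 l))

/-- Piecewise-continuous inputs `PC(T, ℝ^m)`. -/
def PC (m : ℕ) : Type := {u : ℝ≥0 → (Fin m → ℝ) // IsPiecewiseContinuous u}

theorem isPiecewiseContinuous_const {m : ℕ} (a : Fin m → ℝ) :
    IsPiecewiseContinuous (fun _ : ℝ≥0 => a) := by
  refine ⟨fun T => ?_, fun t ht => absurd continuousAt_const ht⟩
  convert Set.finite_empty
  ext t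
  simp [continuousAt_const]

/-- The constant input with value `a`. -/
def PC.const {m : ℕ} (a : Fin m → ℝ) : PC m := ⟨fun _ => a, isPiecewiseContinuous_const a⟩

/-- Non-empty switching sequences `(q₁,t₁)⋯(q_k,t_k)`, where `t_i` is the time spent in `q_i`. -/
def SwitchSeq (Q : Type*) : Type _ := {w : List (Q × ℝ≥0) // w ≠ []}

/-- Input-output maps `PC(T, ℝ^m) × (Q × T)⁺ → ℝ^p`. -/
abbrev IOMap (Q : Type*) (m p : ℕ) : Type _ := PC m → SwitchSeq Q → (Fin p → ℝ)

/-- The list `(q₁,t₁)⋯(q_k,t_k)` for a word `w = q₁⋯q_k` and times `t`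
(used only for `t_i ≥ 0`). -/
noncomputable def timed {Q : Type*} (w : List Q) (t : Fin w.length → ℝ) : List (Q × ℝ≥0) :=
  List.ofFn fun i => (w.get i, (t i).toNNReal)

/-! ### Generalized kernel representations -/

/-- A family of functions `K_w : T^{|w|} → ℝ^p`, `w ∈ Q⁺`, is encoded as one function on switching
sequences, `K_{q₁⋯q_k}(t₁,…,t_k) = K ((q₁,t₁)⋯(q_k,t_k))`; likewise for `G`. Values on the empty
list are irrelevant. -/
def HasKernelRepresentation {Q : Type*} {m p : ℕ} (Φ : Set (IOMap Q m p)) : Prop :=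
  ∃ (K : Φ → List (Q × ℝ≥0) → (Fin p → ℝ)) (G : List (Q × ℝ≥0) → Matrix (Fin p) (Fin m) ℝ),
    -- analyticity on the orthants `T^k`
    (∀ (f : Φ) (w : List Q), w ≠ [] →
      AnalyticOn ℝ (fun t : Fin w.length → ℝ => K f (timed w t)) (Ici 0)) ∧
    (∀ (w : List Q), w ≠ [] → ∀ (i : Fin p) (j : Fin m),
      AnalyticOn ℝ (fun t : Fin w.length → ℝ => G (timed w t) i j) (Ici 0)) ∧
    -- two consecutive stays in the same mode can be merged
    (∀ (f : Φ) (w v : List (Q × ℝ≥0)) (q : Q) (t t' : ℝ≥0),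
      K f (w ++ (q, t) :: (q, t') :: v) = K f (w ++ (q, t + t') :: v)) ∧
    (∀ (w v : List (Q × ℝ≥0)) (q : Q) (t t' : ℝ≥0),
      G (w ++ (q, t) :: (q, t') :: v) = G (w ++ (q, t + t') :: v)) ∧
    -- a stay of length zero can be deleted
    (∀ (f : Φ) (v w : List (Q × ℝ≥0)) (q : Q), w ≠ [] →
      K f (v ++ (q, 0) :: w) = K f (v ++ w)) ∧
    (∀ (v w : List (Q × ℝ≥0)) (q : Q), v ≠ [] → w ≠ [] →
      G (v ++ (q, 0) :: w) = G (v ++ w)) ∧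
    -- the input-output maps are given by the kernels
    (∀ (f : Φ) (u : PC m) (w : SwitchSeq Q),
      f.1 u w = K f w.1 + ∑ i : Fin w.1.length,
        ∫ s in (0 : ℝ)..((w.1.get i).2 : ℝ),
          G (((w.1.get i).1, (((w.1.get i).2 : ℝ) - s).toNNReal) :: w.1.drop (i + 1)) *ᵥ
            u.1 (s.toNNReal + ((w.1.take i).map Prod.snd).sum))

/-! ### Markov parameters -/

/-- `d/dt₁ d/dt₂ ⋯ d/dt_k g(t₁,…,t_k)` at `t = 0`, with (one-sided) derivatives along `[0,∞)`. -/
noncomputable def mixedDeriv {E : Type*} [NormedAddCommGroup E] [NormedSpace ℝ E] :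
    (k : ℕ) → ((Fin k → ℝ) → E) → E
  | 0, g => g Fin.elim0
  | k + 1, g => derivWithin (fun t : ℝ => mixedDeriv k fun s => g (Fin.cons t s)) (Ici 0) 0

/-- `f_{u,wq}(t₁,…,t_k,0)` for `w = q₁⋯q_k`. -/
noncomputable def alongWord {Q : Type*} {m p : ℕ} (f : IOMap Q m p) (u : PC m) (w : List Q) (q : Q)
    (t : Fin w.length → ℝ) : Fin p → ℝ :=
  f u ⟨timed w t ++ [(q, 0)], by simp⟩

/-- `S_{f,q}(w)`. -/
noncomputable def markovInit {Q : Type*} {m p : ℕ} (f : IOMap Q m p) (q : Q) (w : List Q) :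
    Fin p → ℝ :=
  mixedDeriv w.length (alongWord f (PC.const 0) w q)

/-- The expression defining `S_{q,q₀,j}(w)`, evaluated on the input-output map `f`. -/
noncomputable def markovInputOf {Q : Type*} {m p : ℕ} (f : IOMap Q m p) (q q₀ : Q) (j : Fin m)
    (w : List Q) : Fin p → ℝ :=
  mixedDeriv (q₀ :: w).length (alongWord f (PC.const (Pi.single j 1)) (q₀ :: w) q) -
    mixedDeriv (q₀ :: w).length (alongWord f (PC.const 0) (q₀ :: w) q)

open Classical in
/-- `S_{q,q₀,j}(w)`, computed on an arbitrary element of `Φ`; all elements give the same value if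
`Φ` has a generalized kernel representation. For `Φ = ∅` it is `0` by convention. -/
noncomputable def markovInput {Q : Type*} {m p : ℕ} (Φ : Set (IOMap Q m p)) (q q₀ : Q) (j : Fin m)
    (w : List Q) : Fin p → ℝ :=
  if h : Φ.Nonempty then markovInputOf h.some q q₀ j w else 0

/-! ### Hankel matrices; their rank is `Matrix.eRank`, the dimension in `ℕ∞` of the column span -/

/-- `J_Φ = Φ ∪ (Q × {1,…,m})`. -/
abbrev ColIdx {Q : Type*} {m p : ℕ} (Φ : Set (IOMap Q m p)) : Type _ := Φ ⊕ (Q × Fin m)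

/-- `Q^{≤ L}`. -/
abbrev Words (Q : Type*) (L : ℕ) : Type _ := {w : List Q // w.length ≤ L}

/-- The Hankel matrix. The row index `i = pK + r + 1 ∈ {1,…,p|Q|}` attached to an enumeration
`σ₁, σ₂, …` of `Q` is written as the pair `(σ_{K+1}, r) ∈ Q × Fin p`. -/
noncomputable def hankel {Q : Type*} {m p : ℕ} (Φ : Set (IOMap Q m p)) :
    Matrix (List Q × (Q × Fin p)) (List Q × ColIdx Φ) ℝ :=
  fun v w =>
    match w.2 with
    | Sum.inl f => markovInit f.1 v.2.1 (w.1 ++ v.1) v.2.2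
    | Sum.inr j => markovInput Φ v.2.1 j.1 j.2 (w.1 ++ v.1) v.2.2

/-- `H_{Φ,L,M}`. -/
noncomputable def hankelSub {Q : Type*} {m p : ℕ} (Φ : Set (IOMap Q m p)) (L M : ℕ) :
    Matrix (Words Q L × (Q × Fin p)) (Words Q M × ColIdx Φ) ℝ :=
  (hankel Φ).submatrix (Prod.map Subtype.val id) (Prod.map Subtype.val id)

/-- `rank H_{Φ,N,N} = rank H_{Φ,N+1,N} = rank H_{Φ,N,N+1}`. -/
def RankCondition {Q : Type*} {m p : ℕ} (Φ : Set (IOMap Q m p)) (N : ℕ) : Prop :=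
  (hankelSub Φ N N).eRank = (hankelSub Φ (N + 1) N).eRank ∧
    (hankelSub Φ (N + 1) N).eRank = (hankelSub Φ N (N + 1)).eRank

/-! ### Linear switched systems and realizations -/

/-- Linear switched systems with state space `ℝ^n`, inputs `ℝ^m`, outputs `ℝ^p`, modes `Q`. -/
structure LSS (Q : Type*) (n m p : ℕ) where
  A : Q → Matrix (Fin n) (Fin n) ℝ
  B : Q → Matrix (Fin n) (Fin m) ℝ
  C : Q → Matrix (Fin p) (Fin n) ℝ

/-- `x` solves `ẋ = A x + B v` on `[0, t]`: it is continuous there and satisfies the equation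
at all interior times at which the (piecewise-continuous) input `v` is continuous. -/
def IsSolution {n m : ℕ} (A : Matrix (Fin n) (Fin n) ℝ) (B : Matrix (Fin n) (Fin m) ℝ)
    (v : ℝ → Fin m → ℝ) (t : ℝ) (x : ℝ → Fin n → ℝ) : Prop :=
  ContinuousOn x (Icc 0 t) ∧
    ∀ s ∈ Ioo 0 t, ContinuousAt v s → HasDerivAt x (A *ᵥ x s + B *ᵥ v s) s

/-- `Σ.IsState u τ x₀ w x`: started at time `τ` in `x₀` and fed with `u` and the switching sequence
`w`, the system ends up in `x`. -/
def LSS.IsState {Q : Type*} {n m p : ℕ} (sys : LSS Q n m p) (u : PC m) :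
    ℝ≥0 → (Fin n → ℝ) → List (Q × ℝ≥0) → (Fin n → ℝ) → Prop
  | _, x₀, [], x => x = x₀
  | τ, x₀, (q, t) :: w, x =>
      ∃ ξ : ℝ → Fin n → ℝ, ξ 0 = x₀ ∧
        IsSolution (sys.A q) (sys.B q) (fun s => u.1 (s.toNNReal + τ)) t ξ ∧
        sys.IsState u (τ + t) (ξ t) w x

/-- `y = y_Σ(x₀, u, w)`. -/
def LSS.IsOutput {Q : Type*} {n m p : ℕ} (sys : LSS Q n m p) (x₀ : Fin n → ℝ) (u : PC m)
    (w : SwitchSeq Q) (y : Fin p → ℝ) : Prop :=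
  ∃ x : Fin n → ℝ, sys.IsState u 0 x₀ w.1 x ∧ y = sys.C (w.1.getLast w.2).1 *ᵥ x

/-- `A_{q_k} ⋯ A_{q_1}` for the word `q₁⋯q_k`. -/
def LSS.prodA {Q : Type*} {n m p : ℕ} (sys : LSS Q n m p) : List Q → Matrix (Fin n) (Fin n) ℝ
  | [] => 1
  | q :: w => sys.prodA w * sys.A q

/-- Pairs `(Σ, μ)` with `dim Σ = n` and `μ : Φ → ℝ^n`. -/
structure Realization {Q : Type*} {m p : ℕ} (Φ : Set (IOMap Q m p)) (n : ℕ) where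
  sys : LSS Q n m p
  μ : Φ → (Fin n → ℝ)

namespace Realization

variable {Q : Type*} {m p : ℕ} {Φ : Set (IOMap Q m p)} {n n' : ℕ}

/-- `(Σ, μ)` is a realization of `Φ`. -/
def IsRealization (R : Realization Φ n) : Prop :=
  ∀ (f : Φ) (u : PC m) (w : SwitchSeq Q), R.sys.IsOutput (R.μ f) u w (f.1 u w)

/-- `(Σ, μ)` is a minimal realization of `Φ`. -/
def IsMinimalRealization (R : Realization Φ n) : Prop :=
  R.IsRealization ∧ ∀ (k : ℕ) (R' : Realization Φ k), R'.IsRealization → n ≤ k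

/-- `(Σ, μ)` is an `N`-partial realization of `Φ`. -/
def IsPartialRealization (N : ℕ) (R : Realization Φ n) : Prop :=
  ∀ (q : Q) (w : List Q), w.length ≤ N →
    (∀ (q₀ : Q) (j : Fin m), markovInput Φ q q₀ j w =
      (R.sys.C q * R.sys.prodA w * R.sys.B q₀) *ᵥ Pi.single j 1) ∧
    (∀ f : Φ, markovInit f.1 q w = (R.sys.C q * R.sys.prodA w) *ᵥ R.μ f)

/-- `(Σ, μ)` is a minimal `N`-partial realization of `Φ`. -/
def IsMinimalPartialRealization (N : ℕ) (R : Realization Φ n) : Prop :=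
  R.IsPartialRealization N ∧
    ∀ (k : ℕ) (R' : Realization Φ k), R'.IsPartialRealization N → n ≤ k

/-- Existence of an isomorphism of realizations. -/
def Isomorphic (R : Realization Φ n) (R' : Realization Φ n') : Prop :=
  ∃ S : (Fin n → ℝ) ≃ₗ[ℝ] (Fin n' → ℝ),
    (∀ q x, R'.sys.A q *ᵥ S x = S (R.sys.A q *ᵥ x)) ∧
    (∀ q v, R'.sys.B q *ᵥ v = S (R.sys.B q *ᵥ v)) ∧
    (∀ q x, R'.sys.C q *ᵥ S x = R.sys.C q *ᵥ x) ∧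
    (∀ f, S (R.μ f) = R'.μ f)

end Realization

/-! ### The column-space algorithm -/

section ColumnSpaceAlgorithm

variable {Q : Type*} {m p : ℕ} (Φ : Set (IOMap Q m p)) (N : ℕ)

/-- The column space of `H_{Φ,N,N+1}`. -/
noncomputable def colSpace : Submodule ℝ (Words Q N × (Q × Fin p) → ℝ) :=
  Submodule.span ℝ (Set.range (hankelSub Φ N (N + 1)).col)

/-- The column of `H_{Φ,N,N+1}` indexed by `(w, j)`, as an element of the column space. -/
noncomputable def column (w : Words Q (N + 1)) (j : ColIdx Φ) : colSpace Φ N :=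
  ⟨(hankelSub Φ N (N + 1)).col (w, j), Submodule.subset_span ⟨(w, j), rfl⟩⟩

/-- `R` is returned by the algorithm which is run with the isomorphism `S` from the column space
of `H_{Φ,N,N+1}` to `ℝ^n`. -/
def IsColumnSpaceOutput {n : ℕ} (S : colSpace Φ N ≃ₗ[ℝ] (Fin n → ℝ)) (R : Realization Φ n) :
    Prop :=
  (∀ (q : Q) (j : Fin m), (R.sys.B q).col j = S (column Φ N ⟨[], by simp⟩ (Sum.inr (q, j)))) ∧
  (∀ (q : Q) (w : Words Q (N + 1)) (j : ColIdx Φ), R.sys.C q *ᵥ S (column Φ N w j) =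
    fun i => hankelSub Φ N (N + 1) (⟨[], by simp⟩, (q, i)) (w, j)) ∧
  (∀ (q : Q) (w : Words Q N) (j : ColIdx Φ),
    S.symm (R.sys.A q *ᵥ S (column Φ N ⟨w.1, w.2.trans (Nat.le_succ N)⟩ j)) =
      column Φ N ⟨w.1 ++ [q], by simpa using w.2⟩ j) ∧
  (∀ f : Φ, R.μ f = S (column Φ N ⟨[], by simp⟩ (Sum.inl f)))

end ColumnSpaceAlgorithm

/-! ### The factorization (Kalman–Ho-like) algorithm -/

section FactorizationAlgorithm

variable {Q : Type*} {m p : ℕ} {Φ : Set (IOMap Q m p)} {N r : ℕ}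

/-- `H_{Φ,N+1,N} = O R` with `r = rank R = rank O = rank H_{Φ,N+1,N}`. -/
def IsFullRankFactorization (O : Matrix (Words Q (N + 1) × (Q × Fin p)) (Fin r) ℝ)
    (R : Matrix (Fin r) (Words Q N × ColIdx Φ) ℝ) : Prop :=
  hankelSub Φ (N + 1) N = O * R ∧ R.eRank = r ∧ O.eRank = r ∧
    (hankelSub Φ (N + 1) N).eRank = r

/-- `Γ̄`: the rows of `O` indexed by words of length at most `N`. -/
def gammaBar (O : Matrix (Words Q (N + 1) × (Q × Fin p)) (Fin r) ℝ) :
    Matrix (Words Q N × (Q × Fin p)) (Fin r) ℝ :=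
  fun v k => O (⟨v.1.1, v.1.2.trans (Nat.le_succ N)⟩, v.2) k

/-- `Γ̄_q`: the row indexed by `(v, i)` is the row `(qv, i)` of `O`. -/
def gammaShift (O : Matrix (Words Q (N + 1) × (Q × Fin p)) (Fin r) ℝ) (q : Q) :
    Matrix (Words Q N × (Q × Fin p)) (Fin r) ℝ :=
  fun v k => O (⟨q :: v.1.1, by simpa using v.1.2⟩, v.2) k

open Classical in
/-- The algorithm run with the factorization `H_{Φ,N+1,N} = O R`; `none` stands for
`NoRealization`. -/
noncomputable def factorizationAlgorithm
    (O : Matrix (Words Q (N + 1) × (Q × Fin p)) (Fin r) ℝ)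
    (R : Matrix (Fin r) (Words Q N × ColIdx Φ) ℝ) : Option (Realization Φ r) :=
  if h : ∀ q : Q, ∃! A : Matrix (Fin r) (Fin r) ℝ, gammaBar O * A = gammaShift O q then
    some
      { sys :=
          { A := fun q => (h q).choose
            B := fun q => Matrix.of fun k j => R k (⟨[], by simp⟩, Sum.inr (q, j))
            C := fun q => Matrix.of fun i k => O (⟨[], by simp⟩, (q, i)) k }
        μ := fun f k => R k (⟨[], by simp⟩, Sum.inl f) }
  else none

end FactorizationAlgorithm

end LinSwitch

namespace LinSwitch

/-! ### Ranks of matrices with infinitely many rows or columns -/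

section Rank

variable {I J : Type*}

/-! A system of dimension `n` matching the Markov parameters up to length `L + M` factors `H_{L,M}`
through `ℝ^n`: the column `(w, j)` is the observability map, restricted to short words, applied to
the reachable vector `A_w b_j`, where `b_j` is an initial state or an input column. Hence ranks of
Hankel blocks bound dimensions from below, which gives every minimality claim.

Conversely, in a full rank factorization `H_{N+1,N} = O R` the columns of `R` should be the vectors
`A_w b_j` and the rows of `O` the rows of `C_q A_v`. Moving a letter `q` from the column word to the
row word is then the equation `Γ̄ A_q = Γ̄_q`. The rank condition makes `Γ̄` injective, with range
the column space of `H_{N,N+1}`; the range of `Γ̄_q` lies in there, so `A_q` exists and is unique.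
Induction on words confirms the expected form of `R` and `O` (`col_eq`, `row_eq`), and cutting a
word of length at most `2N+1` into pieces of length at most `N` and `N+1` gives the partial
realization. `Γ̄` itself is the isomorphism with the column space model (`gammaEquiv`).

If `H_{N,N}` has the full rank of `H`, truncating rows at length `N` is injective on the whole
column space, so the row shift there is governed by the `A_q` and all Markov parameters match
(`isPartialRealization_of_eRank_eq`). If some realization has dimension at most `N+1`, reachability
and observability are already decided by words of length `N`
(`wordAct_mem_reachSpan_of_finrank_le`), so the two ranks agree.

The analytic half relates Markov parameters to input-output maps. By variation of constants a system
has kernels of its own (`LSS.hasKernels`), whose mixed derivatives at `0` are the products of its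
matrices. In the other direction, analytic kernels obeying the merging and deletion rules are
determined by their mixed derivatives at `0` (`eq_of_wordCoeff_eq`), so equality of all Markov
parameters forces equality of kernels. -/

theorem eRank_eq_finrank (A : Matrix I J ℝ)
    [FiniteDimensional ℝ (Submodule.span ℝ (range A.col))] :
    A.eRank = Module.finrank ℝ (Submodule.span ℝ (range A.col)) := by
  rw [Matrix.eRank, Matrix.cRank, ← Module.finrank_eq_rank, Cardinal.toENat_nat]

theorem finiteDimensional_of_eRank_eq {A : Matrix I J ℝ} {r : ℕ} (h : A.eRank = r) :
    FiniteDimensional ℝ (Submodule.span ℝ (range A.col)) := by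
  rw [Matrix.eRank, Matrix.cRank] at h
  refine Module.rank_lt_aleph0_iff.1 ?_
  rw [← Cardinal.toENat_lt_top, h]
  exact ENat.natCast_lt_top r

theorem finrank_eq_of_eRank_eq {A : Matrix I J ℝ} {r : ℕ} (h : A.eRank = r) :
    Module.finrank ℝ (Submodule.span ℝ (range A.col)) = r := by
  rw [← Matrix.eRank_toNat_eq_finrank, h, ENat.toNat_natCast]

theorem eRank_le_of_col_mem_range {A : Matrix I J ℝ} {n : ℕ} (T : (Fin n → ℝ) →ₗ[ℝ] (I → ℝ))
    (h : ∀ c, A.col c ∈ LinearMap.range T) : A.eRank ≤ n := by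
  have hle : Submodule.span ℝ (range A.col) ≤ LinearMap.range T :=
    Submodule.span_le.2 (by rintro _ ⟨c, rfl⟩; exact h c)
  have : FiniteDimensional ℝ (Submodule.span ℝ (range A.col)) :=
    Submodule.finiteDimensional_of_le hle
  rw [eRank_eq_finrank]
  have h1 := Submodule.finrank_mono hle
  have h2 := T.finrank_range_le
  rw [Module.finrank_fin_fun] at h2
  exact_mod_cast h1.trans h2

theorem finrank_map_of_forall_eq_zero {V W : Type*} [AddCommGroup V] [Module ℝ V]
    [AddCommGroup W] [Module ℝ W] (f : V →ₗ[ℝ] W) {Y : Submodule ℝ V}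
    (h : ∀ y ∈ Y, f y = 0 → y = 0) : Module.finrank ℝ (Y.map f) = Module.finrank ℝ Y := by
  rw [← LinearMap.range_domRestrict]
  refine LinearMap.finrank_range_of_inj ((injective_iff_map_eq_zero _).2 fun y hy => ?_)
  exact Subtype.ext (h y y.2 hy)

/-- The columns of `A * B` span the image under `A` of the span of the columns of `B`. -/
theorem span_col_mul {n : ℕ} (A : Matrix I (Fin n) ℝ) (B : Matrix (Fin n) J ℝ) :
    Submodule.span ℝ (range (A * B).col) =
      (Submodule.span ℝ (range B.col)).map A.mulVecLin := by
  rw [Submodule.map_span, ← range_comp]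
  rfl

/-- A basis of the column space supplies the columns of `O`, and `R` lists the coordinates of the
columns of `A` in it. Finiteness of `I` only serves to make the column space finite-dimensional; `J`
may be infinite. -/
theorem exists_fullRank_factorization [Finite I] (A : Matrix I J ℝ) :
    ∃ (r : ℕ) (O : Matrix I (Fin r) ℝ) (R : Matrix (Fin r) J ℝ),
      A = O * R ∧ R.eRank = r ∧ O.eRank = r ∧ A.eRank = r := by
  set W := Submodule.span ℝ (range A.col) with hW
  let b := Module.finBasis ℝ W
  let c : J → W := fun j => ⟨A.col j, Submodule.subset_span ⟨j, rfl⟩⟩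
  have hc : Submodule.span ℝ (range c) = ⊤ := by
    apply Submodule.map_injective_of_injective W.injective_subtype
    rw [Submodule.map_span, ← range_comp, Submodule.map_top, Submodule.range_subtype]
    rfl
  have hO : Submodule.span ℝ (range (Matrix.of fun i k => (b k : I → ℝ) i).col) = W := by
    have : range (Matrix.of fun i k => (b k : I → ℝ) i).col = W.subtype '' range b := by
      rw [← range_comp]; rfl
    rw [this, ← Submodule.map_span, b.span_eq, Submodule.map_top, Submodule.range_subtype]
  have hR : Submodule.span ℝ (range (Matrix.of fun k j => b.equivFun (c j) k).col) = ⊤ := by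
    have : range (Matrix.of fun k j => b.equivFun (c j) k).col = b.equivFun '' range c := by
      rw [← range_comp]; rfl
    rw [this]
    have h := Submodule.map_span b.equivFun.toLinearMap (range c)
    rw [hc, Submodule.map_top, LinearEquiv.range] at h
    exact h.symm
  refine ⟨_, Matrix.of fun i k => (b k : I → ℝ) i, Matrix.of fun k j => b.equivFun (c j) k,
    ?_, ?_, ?_, eRank_eq_finrank A⟩
  · ext i j
    have h := congrArg (fun x : W => (x : I → ℝ) i) (b.sum_equivFun (c j))
    simp only [AddSubmonoidClass.coe_finsetSum, Finset.sum_apply, Submodule.coe_smul,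
      Pi.smul_apply, smul_eq_mul] at h
    simp only [Matrix.mul_apply, Matrix.of_apply]
    rw [← show (c j : I → ℝ) i = A i j from rfl, ← h]
    exact Finset.sum_congr rfl fun k _ => mul_comm _ _
  · rw [eRank_eq_finrank, hR, finrank_top, Module.finrank_fin_fun]
  · rw [eRank_eq_finrank, hO]

end Rank

/-! ### Saturation of reachable subspaces -/

section Saturation

variable {Q J V : Type*} [AddCommGroup V] [Module ℝ V]

/-- The vector `T_{q_k} ⋯ T_{q_1} x` for the word `q₁⋯q_k`. -/
def wordAct (T : Q → V →ₗ[ℝ] V) : List Q → V → V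
  | [], x => x
  | q :: w, x => wordAct T w (T q x)

theorem wordAct_append (T : Q → V →ₗ[ℝ] V) (w v : List Q) (x : V) :
    wordAct T (w ++ v) x = wordAct T v (wordAct T w x) := by
  induction w generalizing x with
  | nil => rfl
  | cons q w ih => exact ih _

/-- The span of the vectors reached from the `b j` by words of length at most `k`. -/
def reachSpan (T : Q → V →ₗ[ℝ] V) (b : J → V) (k : ℕ) : Submodule ℝ V :=
  Submodule.span ℝ {x | ∃ (w : List Q) (j : J), w.length ≤ k ∧ x = wordAct T w (b j)}

theorem reachSpan_mono (T : Q → V →ₗ[ℝ] V) (b : J → V) : Monotone (reachSpan T b) := by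
  intro k l hkl
  refine Submodule.span_mono ?_
  rintro x ⟨w, j, hw, rfl⟩
  exact ⟨w, j, hw.trans hkl, rfl⟩

theorem map_mem_reachSpan (T : Q → V →ₗ[ℝ] V) (b : J → V) (q : Q) {k : ℕ} {x : V}
    (hx : x ∈ reachSpan T b k) : T q x ∈ reachSpan T b (k + 1) := by
  have : reachSpan T b k ≤ (reachSpan T b (k + 1)).comap (T q) := by
    refine Submodule.span_le.2 ?_
    rintro x ⟨w, j, hw, rfl⟩
    refine Submodule.subset_span ⟨w ++ [q], j, by simpa using hw, ?_⟩
    rw [wordAct_append]; rfl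
  exact this hx

/-- Once the chain of spans pauses for one step, its current member is invariant under every `T q`
and contains all `b j`. -/
theorem wordAct_mem_of_reachSpan_eq (T : Q → V →ₗ[ℝ] V) (b : J → V) {k : ℕ}
    (h : reachSpan T b (k + 1) = reachSpan T b k) (w : List Q) (j : J) :
    wordAct T w (b j) ∈ reachSpan T b k := by
  induction w using List.reverseRecOn with
  | nil => exact Submodule.subset_span ⟨[], j, by simp, rfl⟩
  | append_singleton w q ih =>
    rw [wordAct_append, ← h]
    exact map_mem_reachSpan T b q ih

/-- Dimension count along the chain of spans. Length `N` suffices in dimension `N + 1` because the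
chain starts in dimension at least one unless all `b j` vanish. -/
theorem wordAct_mem_reachSpan_of_finrank_le [FiniteDimensional ℝ V] (T : Q → V →ₗ[ℝ] V)
    (b : J → V) {N : ℕ} (hN : Module.finrank ℝ V ≤ N + 1) (w : List Q) (j : J) :
    wordAct T w (b j) ∈ reachSpan T b N := by
  by_cases hex : ∃ k ≤ N, reachSpan T b (k + 1) = reachSpan T b k
  · obtain ⟨k, hk, h⟩ := hex
    exact reachSpan_mono T b hk (wordAct_mem_of_reachSpan_eq T b h w j)
  push Not at hex
  have hlt : ∀ k ≤ N, reachSpan T b k < reachSpan T b (k + 1) := fun k hk =>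
    lt_of_le_of_ne (reachSpan_mono T b k.le_succ) (hex k hk).symm
  have hdim : ∀ k ≤ N + 1,
      Module.finrank ℝ (reachSpan T b 0) + k ≤ Module.finrank ℝ (reachSpan T b k) := by
    intro k
    induction k with
    | zero => intro _; simp
    | succ k ih =>
      intro hk
      have h1 := ih (by omega)
      have h2 := Submodule.finrank_lt_finrank_of_lt (hlt k (by omega))
      omega
  have h1 := hdim (N + 1) le_rfl
  have h2 := Submodule.finrank_le (reachSpan T b (N + 1))
  -- The `N + 1` strict inclusions use up the whole dimension and leave nothing for the span of the
  -- `b j`; but then the chain is constantly zero, contradicting strictness at `0`.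
  have h0 : reachSpan T b 0 = ⊥ := Submodule.finrank_eq_zero.1 (by omega)
  refine absurd ?_ (hex 0 (Nat.zero_le N))
  rw [h0]
  refine Submodule.span_eq_bot.2 ?_
  rintro x ⟨w, j, -, rfl⟩
  have hb : b j = 0 := by
    rw [← Submodule.mem_bot ℝ, ← h0]
    exact Submodule.subset_span ⟨[], j, by simp, rfl⟩
  rw [hb]
  induction w with
  | nil => rfl
  | cons q w ih => rwa [wordAct, map_zero]

end Saturation

/-! ### Hankel matrices and partial realizations -/

section Markov

variable {Q : Type*} {m p : ℕ} {Φ : Set (IOMap Q m p)} {n : ℕ}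

/-- The Markov parameters, indexed like the columns of the Hankel matrix. -/
noncomputable def markov (Φ : Set (IOMap Q m p)) (j : ColIdx Φ) (q : Q) (w : List Q) : Fin p → ℝ :=
  match j with
  | Sum.inl f => markovInit f.1 q w
  | Sum.inr j => markovInput Φ q j.1 j.2 w

theorem hankel_apply (v w : List Q) (q : Q) (i : Fin p) (j : ColIdx Φ) :
    hankel Φ (v, (q, i)) (w, j) = markov Φ j q (w ++ v) i := by
  cases j <;> rfl

theorem hankelSub_apply {L M : ℕ} (v : Words Q L) (w : Words Q M) (q : Q) (i : Fin p)
    (j : ColIdx Φ) : hankelSub Φ L M (v, (q, i)) (w, j) = markov Φ j q (w.1 ++ v.1) i :=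
  hankel_apply _ _ _ _ _

/-- The initial states and the columns of the input matrices. -/
def Realization.inVec (Z : Realization Φ n) (j : ColIdx Φ) : Fin n → ℝ :=
  match j with
  | Sum.inl f => Z.μ f
  | Sum.inr j => (Z.sys.B j.1).col j.2

theorem LSS.prodA_append (sys : LSS Q n m p) (w v : List Q) :
    sys.prodA (w ++ v) = sys.prodA v * sys.prodA w := by
  induction w with
  | nil => simp [LSS.prodA]
  | cons q w ih => simp [LSS.prodA, ih, Matrix.mul_assoc]

theorem Realization.isPartialRealization_iff (Z : Realization Φ n) (M : ℕ) :
    Z.IsPartialRealization M ↔ ∀ (q : Q) (w : List Q), w.length ≤ M → ∀ j : ColIdx Φ,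
      markov Φ j q w = (Z.sys.C q * Z.sys.prodA w) *ᵥ Z.inVec j := by
  refine forall₂_congr fun q w => imp_congr_right fun _ => ?_
  rw [Sum.forall, and_comm, Prod.forall]
  refine and_congr Iff.rfl (forall₂_congr fun q₀ j => ?_)
  rw [← Matrix.mulVec_mulVec, Matrix.mulVec_single_one]
  rfl

/-- The Markov parameters which the system produces from the state `x`. -/
def LSS.obs (sys : LSS Q n m p) : (Fin n → ℝ) →ₗ[ℝ] (List Q × (Q × Fin p) → ℝ) where
  toFun x v := ((sys.C v.2.1 * sys.prodA v.1) *ᵥ x) v.2.2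
  map_add' x y := by ext v; simp [Matrix.mulVec_add]
  map_smul' c x := by ext v; simp [Matrix.mulVec_smul]

/-- Restriction of a column of the Hankel matrix to words of length at most `L`. -/
def restrictRows (Q : Type*) (p L : ℕ) :
    (List Q × (Q × Fin p) → ℝ) →ₗ[ℝ] (Words Q L × (Q × Fin p) → ℝ) :=
  LinearMap.funLeft ℝ ℝ (Prod.map Subtype.val id)

/-- The Hankel block factors as observability times reachability; concatenated words have length at
most `M + L`, which is why this order of partial realization is needed. -/
theorem Realization.IsPartialRealization.hankelSub_col {Z : Realization Φ n} {L M : ℕ}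
    (h : Z.IsPartialRealization (M + L)) (w : Words Q M) (j : ColIdx Φ) :
    (hankelSub Φ L M).col (w, j) =
      restrictRows Q p L (Z.sys.obs (Z.sys.prodA w.1 *ᵥ Z.inVec j)) := by
  ext ⟨v, q, i⟩
  rw [Matrix.col_apply, hankelSub_apply, (Z.isPartialRealization_iff _).1 h q (w.1 ++ v.1)
    (by have := w.2; have := v.2; simp; omega) j, Z.sys.prodA_append, ← Matrix.mul_assoc,
    ← Matrix.mulVec_mulVec]
  rfl

theorem Realization.hankel_col {Z : Realization Φ n} (h : ∀ M, Z.IsPartialRealization M)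
    (w : List Q) (j : ColIdx Φ) :
    (hankel Φ).col (w, j) = Z.sys.obs (Z.sys.prodA w *ᵥ Z.inVec j) := by
  ext ⟨v, q, i⟩
  rw [Matrix.col_apply, hankel_apply, (Z.isPartialRealization_iff _).1 (h _) q (w ++ v) le_rfl j,
    Z.sys.prodA_append, ← Matrix.mul_assoc, ← Matrix.mulVec_mulVec]
  rfl

theorem Realization.IsPartialRealization.eRank_hankelSub_le {Z : Realization Φ n} {L M : ℕ}
    (h : Z.IsPartialRealization (M + L)) : (hankelSub Φ L M).eRank ≤ n :=
  eRank_le_of_col_mem_range (restrictRows Q p L ∘ₗ Z.sys.obs) fun c =>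
    ⟨Z.sys.prodA c.1.1 *ᵥ Z.inVec c.2, (h.hankelSub_col c.1 c.2).symm⟩

theorem Realization.eRank_hankel_le {Z : Realization Φ n} (h : ∀ M, Z.IsPartialRealization M) :
    (hankel Φ).eRank ≤ n :=
  eRank_le_of_col_mem_range Z.sys.obs fun c =>
    ⟨Z.sys.prodA c.1 *ᵥ Z.inVec c.2, (Realization.hankel_col h c.1 c.2).symm⟩

theorem hankelSub_eRank_mono {L M L' M' : ℕ} (hL : L ≤ L') (hM : M ≤ M') :
    (hankelSub Φ L M).eRank ≤ (hankelSub Φ L' M').eRank := by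
  have h : hankelSub Φ L M = (hankelSub Φ L' M').submatrix
      (Prod.map (fun v => (⟨v.1, v.2.trans hL⟩ : Words Q L')) id)
      (Prod.map (fun w => (⟨w.1, w.2.trans hM⟩ : Words Q M')) id) := rfl
  rw [h]
  exact Matrix.eRank_submatrix_le _ _ _

theorem hankelSub_eRank_le (L M : ℕ) : (hankelSub Φ L M).eRank ≤ (hankel Φ).eRank :=
  (hankel Φ).eRank_submatrix_le _ _

/-- Both enlarged blocks lie between `H_{N,N}` and the full matrix, so their ranks are squeezed. -/
theorem rankCondition_of_eRank_eq {N : ℕ} (h : (hankelSub Φ N N).eRank = (hankel Φ).eRank) :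
    RankCondition Φ N := by
  have h1 : (hankelSub Φ (N + 1) N).eRank = (hankelSub Φ N N).eRank :=
    le_antisymm ((hankelSub_eRank_le _ _).trans h.ge) (hankelSub_eRank_mono N.le_succ le_rfl)
  have h2 : (hankelSub Φ N (N + 1)).eRank = (hankelSub Φ N N).eRank :=
    le_antisymm ((hankelSub_eRank_le _ _).trans h.ge) (hankelSub_eRank_mono le_rfl N.le_succ)
  exact ⟨h1.symm, h1.trans h2.symm⟩

theorem LSS.wordAct_mulVecLin (sys : LSS Q n m p) (w : List Q) (x : Fin n → ℝ) :
    wordAct (fun q => (sys.A q).mulVecLin) w x = sys.prodA w *ᵥ x := by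
  induction w generalizing x with
  | nil => simp [wordAct, LSS.prodA]
  | cons q w ih => simp [wordAct, LSS.prodA, ih]

/-- Acting on row vectors reverses the order of the letters. This lets the saturation argument for
reachability serve for observability as well. -/
theorem LSS.wordAct_vecMulLinear (sys : LSS Q n m p) (w : List Q) (x : Fin n → ℝ) :
    wordAct (fun q => (sys.A q).vecMulLinear) w.reverse x = x ᵥ* sys.prodA w := by
  induction w generalizing x with
  | nil => simp [wordAct, LSS.prodA]
  | cons q w ih => simp [wordAct, wordAct_append, LSS.prodA, ih]

/-- A state which is unobservable along all words of length at most `N` is unobservable if the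
dimension is at most `N + 1`. -/
theorem LSS.obs_eq_zero_of_restrictRows (sys : LSS Q n m p) {N : ℕ} (hn : n ≤ N + 1)
    {x : Fin n → ℝ} (hx : restrictRows Q p N (sys.obs x) = 0) : sys.obs x = 0 := by
  have hobs : ∀ (v : List Q) (q : Q) (i : Fin p),
      sys.obs x (v, (q, i)) = ((sys.C q).row i ᵥ* sys.prodA v) ⬝ᵥ x := fun v q i => by
    rw [← Matrix.dotProduct_mulVec]
    change ((sys.C q * sys.prodA v) *ᵥ x) i = _
    rw [← Matrix.mulVec_mulVec]; rfl
  let c : Q × Fin p → (Fin n → ℝ) := fun i => (sys.C i.1).row i.2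
  -- Dual saturation: `x` is annihilated by the rows of `C_q A_v` with `v` of length at most `N`,
  -- and in dimension at most `N + 1` these span all such rows.
  have hspan : reachSpan (fun q => (sys.A q).vecMulLinear) c N ≤
      LinearMap.ker ((dotProductBilin ℝ ℝ).flip x : (Fin n → ℝ) →ₗ[ℝ] ℝ) := by
    refine Submodule.span_le.2 ?_
    rintro y ⟨w, ⟨q, i⟩, hw, rfl⟩
    have h := congrFun hx (⟨w.reverse, by simpa using hw⟩, (q, i))
    change sys.obs x (w.reverse, (q, i)) = 0 at h
    rw [hobs, ← sys.wordAct_vecMulLinear, List.reverse_reverse] at h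
    exact h
  ext ⟨v, q, i⟩
  rw [hobs, ← sys.wordAct_vecMulLinear]
  exact hspan (wordAct_mem_reachSpan_of_finrank_le _ c (by simpa using hn) v.reverse (q, i))

/-- Saturated reachability reduces the columns to words of length at most `N`: the full column space
is the image of `X` under the observability map. Saturated observability makes row truncation
injective on that image, so no rank is lost. -/
theorem eRank_hankelSub_eq_of_isPartialRealization {Z : Realization Φ n}
    (h : ∀ M, Z.IsPartialRealization M) {N : ℕ} (hn : n ≤ N + 1) :
    (hankelSub Φ N N).eRank = (hankel Φ).eRank := by
  let X := reachSpan (fun q => (Z.sys.A q).mulVecLin) Z.inVec N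
  have h1 : Submodule.span ℝ (range (hankel Φ).col) = X.map Z.sys.obs := by
    apply le_antisymm
    · refine Submodule.span_le.2 ?_
      rintro _ ⟨⟨w, j⟩, rfl⟩
      refine ⟨_, wordAct_mem_reachSpan_of_finrank_le _ _ (by simpa using hn) w j, ?_⟩
      rw [Realization.hankel_col h, LSS.wordAct_mulVecLin]
    · rw [show X = Submodule.span ℝ _ from rfl, Submodule.map_span]
      refine Submodule.span_mono ?_
      rintro _ ⟨_, ⟨w, j, -, rfl⟩, rfl⟩
      exact ⟨(w, j), by rw [Realization.hankel_col h, LSS.wordAct_mulVecLin]⟩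
  have h2 : Submodule.span ℝ (range (hankelSub Φ N N).col) =
      (X.map Z.sys.obs).map (restrictRows Q p N) := by
    rw [show X = Submodule.span ℝ _ from rfl, Submodule.map_span, Submodule.map_span]
    congr 1
    ext y
    constructor
    · rintro ⟨⟨w, j⟩, rfl⟩
      refine ⟨_, ⟨_, ⟨w.1, j, w.2, rfl⟩, rfl⟩, ?_⟩
      rw [(h (N + N)).hankelSub_col, LSS.wordAct_mulVecLin]
    · rintro ⟨_, ⟨_, ⟨w, j, hw, rfl⟩, rfl⟩, rfl⟩
      exact ⟨(⟨w, hw⟩, j), by rw [(h (N + N)).hankelSub_col, LSS.wordAct_mulVecLin]⟩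
  have i1 : FiniteDimensional ℝ (Submodule.span ℝ (range (hankel Φ).col)) := by
    rw [h1]; infer_instance
  have i2 : FiniteDimensional ℝ (Submodule.span ℝ (range (hankelSub Φ N N).col)) := by
    rw [h2]; infer_instance
  rw [eRank_eq_finrank, eRank_eq_finrank, h1, h2]
  congr 1
  refine finrank_map_of_forall_eq_zero _ ?_
  rintro _ ⟨x, -, rfl⟩ hx
  exact Z.sys.obs_eq_zero_of_restrictRows hn hx

end Markov

end LinSwitch

namespace LinSwitch

/-! ### The state-space realization obtained from a full rank factorization -/

section Algorithms

variable {Q : Type*} {m p : ℕ} {Φ : Set (IOMap Q m p)} {N r : ℕ}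

theorem column_coe_apply (w : Words Q (N + 1)) (j : ColIdx Φ) (v : Words Q N) (q : Q)
    (i : Fin p) : (column Φ N w j : Words Q N × (Q × Fin p) → ℝ) (v, (q, i)) =
      markov Φ j q (w.1 ++ v.1) i :=
  hankelSub_apply v w q i j

section Factorization

variable {O : Matrix (Words Q (N + 1) × (Q × Fin p)) (Fin r) ℝ}
  {R : Matrix (Fin r) (Words Q N × ColIdx Φ) ℝ}

theorem IsFullRankFactorization.span_col_eq_top (hOR : IsFullRankFactorization O R) :
    Submodule.span ℝ (range R.col) = ⊤ :=
  Submodule.eq_top_of_finrank_eq <| by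
    rw [finrank_eq_of_eRank_eq hOR.2.1, Module.finrank_fin_fun]

theorem IsFullRankFactorization.row_mulVec (hOR : IsFullRankFactorization O R)
    (v : Words Q (N + 1)) (q : Q) (i : Fin p) (w : Words Q N) (j : ColIdx Φ) :
    (O *ᵥ R.col (w, j)) (v, (q, i)) = markov Φ j q (w.1 ++ v.1) i := by
  rw [← hankelSub_apply v w q i j, hOR.1]
  rfl

theorem IsFullRankFactorization.gammaBar_mulVec (hOR : IsFullRankFactorization O R)
    (w : Words Q N) (j : ColIdx Φ) : gammaBar O *ᵥ R.col (w, j) =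
      column Φ N ⟨w.1, w.2.trans (Nat.le_succ N)⟩ j := by
  ext ⟨v, q, i⟩
  rw [column_coe_apply, ← hOR.row_mulVec ⟨v.1, v.2.trans (Nat.le_succ N)⟩ q i w j]
  rfl

theorem IsFullRankFactorization.gammaShift_mulVec (hOR : IsFullRankFactorization O R) (q : Q)
    (w : Words Q N) (j : ColIdx Φ) : gammaShift O q *ᵥ R.col (w, j) =
      column Φ N ⟨w.1 ++ [q], by simpa using w.2⟩ j := by
  ext ⟨v, q', i⟩
  rw [column_coe_apply]
  have h := hOR.row_mulVec ⟨q :: v.1, by simpa using v.2⟩ q' i w j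
  simp only [List.append_assoc, List.singleton_append]
  rw [← h]
  rfl

theorem IsFullRankFactorization.gammaBar_mul (hOR : IsFullRankFactorization O R) :
    gammaBar O * R = hankelSub Φ N N := by
  ext ⟨v, q, i⟩ ⟨w, j⟩
  rw [hankelSub_apply, ← hOR.row_mulVec ⟨v.1, v.2.trans (Nat.le_succ N)⟩ q i w j]
  rfl

theorem IsFullRankFactorization.range_gammaBar (hOR : IsFullRankFactorization O R) :
    LinearMap.range (gammaBar O).mulVecLin = Submodule.span ℝ (range (hankelSub Φ N N).col) := by
  rw [← hOR.gammaBar_mul, span_col_mul, hOR.span_col_eq_top, Submodule.map_top]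

/-- The range of `Γ̄` is the column space of `H_{N,N}`, of dimension `r` by the rank condition, so
rank-nullity leaves no kernel in `ℝ^r`. -/
theorem IsFullRankFactorization.injective_gammaBar (hOR : IsFullRankFactorization O R)
    (hrank : RankCondition Φ N) : Function.Injective (gammaBar O).mulVecLin := by
  have h1 : (hankelSub Φ N N).eRank = r := hrank.1.trans hOR.2.2.2
  have h2 := (gammaBar O).mulVecLin.finrank_range_add_finrank_ker
  rw [hOR.range_gammaBar, finrank_eq_of_eRank_eq h1, Module.finrank_fin_fun] at h2
  exact LinearMap.ker_eq_bot.1 (Submodule.finrank_eq_zero.1 (by omega))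

theorem IsFullRankFactorization.range_gammaBar_eq_colSpace (hOR : IsFullRankFactorization O R)
    (hrank : RankCondition Φ N) : LinearMap.range (gammaBar O).mulVecLin = colSpace Φ N := by
  have h1 : (hankelSub Φ N N).eRank = r := hrank.1.trans hOR.2.2.2
  have h2 : (hankelSub Φ N (N + 1)).eRank = r := hrank.2.symm.trans hOR.2.2.2
  have : FiniteDimensional ℝ (colSpace Φ N) := finiteDimensional_of_eRank_eq h2
  rw [hOR.range_gammaBar]
  refine Submodule.eq_of_le_of_finrank_eq (Submodule.span_mono ?_) ?_
  · rintro _ ⟨⟨w, j⟩, rfl⟩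
    exact ⟨(⟨w.1, w.2.trans (Nat.le_succ N)⟩, j), rfl⟩
  · exact (finrank_eq_of_eRank_eq h1).trans (finrank_eq_of_eRank_eq h2).symm

/-- `Γ̄_q` sends the column `w` of `R` to the column `wq` of `H_{N,N+1}`, which lies in the range of
the injective `Γ̄`. As the columns of `R` span, the equation can be solved basis vector by basis
vector. -/
theorem IsFullRankFactorization.existsUnique_mul_eq (hOR : IsFullRankFactorization O R)
    (hrank : RankCondition Φ N) (q : Q) :
    ∃! A : Matrix (Fin r) (Fin r) ℝ, gammaBar O * A = gammaShift O q := by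
  have hinj := hOR.injective_gammaBar hrank
  have hmem : ∀ x, gammaShift O q *ᵥ x ∈ LinearMap.range (gammaBar O).mulVecLin := by
    have h : Submodule.span ℝ (range R.col) ≤
        (LinearMap.range (gammaBar O).mulVecLin).comap (gammaShift O q).mulVecLin := by
      refine Submodule.span_le.2 ?_
      rintro _ ⟨⟨w, j⟩, rfl⟩
      change gammaShift O q *ᵥ R.col (w, j) ∈ LinearMap.range (gammaBar O).mulVecLin
      rw [hOR.gammaShift_mulVec, hOR.range_gammaBar_eq_colSpace hrank]
      exact Subtype.property _
    rw [hOR.span_col_eq_top] at h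
    exact fun x => h Submodule.mem_top
  choose g hg using fun k => hmem (Pi.single k 1)
  refine ⟨Matrix.of fun i k => g k i, ?_, ?_⟩
  · ext v k
    have := congrFun (hg k) v
    rw [Matrix.mulVec_single_one] at this
    exact this
  · intro A hA
    ext i k
    have : (fun i => A i k) = g k := by
      apply hinj
      rw [hg k, Matrix.mulVec_single_one, ← hA]
      rfl
    exact congrFun this i

/-- The properties by which the output of the factorization algorithm is characterized. -/
structure Realization.IsFactorizationOutput (Z : Realization Φ r)
    (O : Matrix (Words Q (N + 1) × (Q × Fin p)) (Fin r) ℝ)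
    (R : Matrix (Fin r) (Words Q N × ColIdx Φ) ℝ) : Prop where
  gammaBar_mul : ∀ q, gammaBar O * Z.sys.A q = gammaShift O q
  inVec_eq : ∀ j, Z.inVec j = R.col (⟨[], by simp⟩, j)
  output_eq : ∀ q i k, Z.sys.C q i k = O (⟨[], by simp⟩, (q, i)) k

theorem IsFullRankFactorization.exists_output (hOR : IsFullRankFactorization O R)
    (hrank : RankCondition Φ N) :
    ∃ Z : Realization Φ r, factorizationAlgorithm O R = some Z ∧ Z.IsFactorizationOutput O R := by
  have h := hOR.existsUnique_mul_eq hrank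
  refine ⟨_, dif_pos h, fun q => (h q).choose_spec.1, ?_, fun _ _ _ => rfl⟩
  rintro (f | j) <;> rfl

namespace Realization.IsFactorizationOutput

variable {Z : Realization Φ r}

/-- Both the column `wq` of `R` and `A_q` times the column `w` are sent by `Γ̄` to the Hankel column
`wq`; injectivity of `Γ̄` drives the induction on the last letter. -/
theorem col_eq (hZ : Z.IsFactorizationOutput O R) (hOR : IsFullRankFactorization O R)
    (hrank : RankCondition Φ N) (w : Words Q N) (j : ColIdx Φ) :
    R.col (w, j) = Z.sys.prodA w.1 *ᵥ Z.inVec j := by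
  obtain ⟨w, hw⟩ := w
  induction w using List.reverseRecOn with
  | nil => simp [LSS.prodA, hZ.inVec_eq]
  | append_singleton w q ih =>
    have hw' : w.length + 1 ≤ N := by simpa using hw
    apply hOR.injective_gammaBar hrank
    rw [Z.sys.prodA_append, ← Matrix.mulVec_mulVec, ← ih (by omega)]
    simp only [LSS.prodA, Matrix.one_mul, Matrix.mulVecLin_apply]
    rw [Matrix.mulVec_mulVec, hZ.gammaBar_mul, hOR.gammaBar_mulVec, hOR.gammaShift_mulVec]

/-- Row `av` of `O` is a row of `Γ̄_a = Γ̄ A_a`, that is, row `v` of `O` times `A_a`. The tail has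
length at most `N`, so the extra layer of rows is covered. -/
theorem row_eq (hZ : Z.IsFactorizationOutput O R) (v : Words Q (N + 1)) (q : Q) (i : Fin p) :
    O (v, (q, i)) = (Z.sys.C q * Z.sys.prodA v.1) i := by
  obtain ⟨v, hv⟩ := v
  induction v with
  | nil => ext k; simp [LSS.prodA, hZ.output_eq]
  | cons a v ih =>
    have hv' : v.length ≤ N := by simpa using hv
    ext k
    have h := congrFun (congrFun (hZ.gammaBar_mul a) (⟨v, hv'⟩, (q, i))) k
    rw [LSS.prodA, ← Matrix.mul_assoc]
    refine h.symm.trans ?_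
    rw [Matrix.mul_apply, Matrix.mul_apply]
    refine Finset.sum_congr rfl fun l _ => ?_
    rw [← ih (hv'.trans (Nat.le_succ N))]
    rfl

theorem isPartialRealization (hZ : Z.IsFactorizationOutput O R)
    (hOR : IsFullRankFactorization O R) (hrank : RankCondition Φ N) :
    Z.IsPartialRealization (2 * N + 1) := by
  rw [Z.isPartialRealization_iff]
  intro q w hw j
  ext i
  -- The first `N` letters go into the column index and the remaining at most `N + 1` into the row
  -- index; the length `2N + 1` is the sum of these two capacities.
  have h := hOR.row_mulVec ⟨w.drop N, by simp; omega⟩ q i ⟨w.take N, by simp⟩ j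
  simp only [List.take_append_drop] at h
  rw [← h, hZ.col_eq hOR hrank]
  conv_rhs => rw [← List.take_append_drop N w, Z.sys.prodA_append, ← Matrix.mul_assoc,
    ← Matrix.mulVec_mulVec]
  exact congrArg (· ⬝ᵥ _) (hZ.row_eq _ q i)

theorem isMinimalPartialRealization (hZ : Z.IsFactorizationOutput O R)
    (hOR : IsFullRankFactorization O R) (hrank : RankCondition Φ N) :
    Z.IsMinimalPartialRealization (2 * N + 1) := by
  refine ⟨hZ.isPartialRealization hOR hrank, fun k Z' hZ' => ?_⟩
  have h : Z'.IsPartialRealization (N + N) := fun q w hw => hZ' q w (by omega)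
  have h' := h.eRank_hankelSub_le
  rw [hrank.1, hOR.2.2.2] at h'
  exact_mod_cast h'

/-- This reaches words of length `N + 1`, one more than the columns of `R`, since the last letter is
absorbed by `Γ̄_q`. -/
theorem gammaBar_prodA (hZ : Z.IsFactorizationOutput O R) (hOR : IsFullRankFactorization O R)
    (hrank : RankCondition Φ N) (w : Words Q (N + 1)) (j : ColIdx Φ) :
    gammaBar O *ᵥ (Z.sys.prodA w.1 *ᵥ Z.inVec j) = column Φ N w j := by
  obtain ⟨w, hw⟩ := w
  induction w using List.reverseRecOn with
  | nil => rw [← hZ.col_eq hOR hrank ⟨[], by simp⟩ j, hOR.gammaBar_mulVec]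
  | append_singleton w q ih =>
    have hw' : w.length ≤ N := by simpa using hw
    rw [Z.sys.prodA_append, ← Matrix.mulVec_mulVec, ← hZ.col_eq hOR hrank ⟨w, hw'⟩ j]
    simp only [LSS.prodA, Matrix.one_mul]
    rw [Matrix.mulVec_mulVec, hZ.gammaBar_mul, hOR.gammaShift_mulVec]

/-- `Γ̄` as an isomorphism onto the column space of `H_{Φ,N,N+1}`. -/
noncomputable def gammaEquiv (hOR : IsFullRankFactorization O R) (hrank : RankCondition Φ N) :
    (Fin r → ℝ) ≃ₗ[ℝ] colSpace Φ N :=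
  (LinearEquiv.ofInjective _ (hOR.injective_gammaBar hrank)).trans
    (LinearEquiv.ofEq _ _ (hOR.range_gammaBar_eq_colSpace hrank))

theorem gammaEquiv_prodA (hZ : Z.IsFactorizationOutput O R) (hOR : IsFullRankFactorization O R)
    (hrank : RankCondition Φ N) (w : Words Q (N + 1)) (j : ColIdx Φ) :
    gammaEquiv hOR hrank (Z.sys.prodA w.1 *ᵥ Z.inVec j) = column Φ N w j :=
  Subtype.ext (hZ.gammaBar_prodA hOR hrank w j)

theorem gammaEquiv_inVec (hZ : Z.IsFactorizationOutput O R) (hOR : IsFullRankFactorization O R)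
    (hrank : RankCondition Φ N) (j : ColIdx Φ) :
    gammaEquiv hOR hrank (Z.inVec j) = column Φ N ⟨[], by simp⟩ j := by
  rw [← hZ.gammaEquiv_prodA hOR hrank]
  simp [LSS.prodA]

theorem C_prodA (hZ : Z.IsFactorizationOutput O R) (hOR : IsFullRankFactorization O R)
    (hrank : RankCondition Φ N) (q : Q) (w : Words Q (N + 1)) (j : ColIdx Φ) :
    Z.sys.C q *ᵥ (Z.sys.prodA w.1 *ᵥ Z.inVec j) =
      fun i => hankelSub Φ N (N + 1) (⟨[], by simp⟩, (q, i)) (w, j) := by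
  ext i
  rw [hankelSub_apply, Matrix.mulVec_mulVec, List.append_nil,
    (Z.isPartialRealization_iff _).1 (hZ.isPartialRealization hOR hrank) q w.1
      (by have := w.2; omega)]

/-- The output is `Z` transported along `S` after `Γ̄`; in particular the column shift is well
defined because it is conjugate to `A_q`. -/
theorem exists_isColumnSpaceOutput (hZ : Z.IsFactorizationOutput O R)
    (hOR : IsFullRankFactorization O R) (hrank : RankCondition Φ N) {n : ℕ}
    (S : colSpace Φ N ≃ₗ[ℝ] (Fin n → ℝ)) :
    ∃ Z' : Realization Φ n, IsColumnSpaceOutput Φ N S Z' := by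
  let T := (gammaEquiv hOR hrank).trans S
  have hT : ∀ (w : Words Q (N + 1)) (j : ColIdx Φ),
      S (column Φ N w j) = T (Z.sys.prodA w.1 *ᵥ Z.inVec j) := fun w j => by
    rw [← hZ.gammaEquiv_prodA hOR hrank w j]; rfl
  refine ⟨⟨⟨fun q => LinearMap.toMatrix' (T.toLinearMap ∘ₗ (Z.sys.A q).mulVecLin ∘ₗ
      T.symm.toLinearMap), fun q => Matrix.of fun i j => T ((Z.sys.B q).col j) i,
      fun q => LinearMap.toMatrix' ((Z.sys.C q).mulVecLin ∘ₗ T.symm.toLinearMap)⟩,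
      fun f => T (Z.μ f)⟩, ?_, ?_, ?_, ?_⟩
  · intro q j
    rw [← hZ.gammaEquiv_inVec hOR hrank]
    rfl
  · intro q w j
    simp only [hT, LinearMap.toMatrix'_mulVec, LinearMap.comp_apply, LinearEquiv.coe_coe,
      LinearEquiv.symm_apply_apply, Matrix.mulVecLin_apply]
    exact hZ.C_prodA hOR hrank q w j
  · intro q w j
    rw [LinearEquiv.symm_apply_eq, hT, hT, Z.sys.prodA_append]
    simp only [LinearMap.toMatrix'_mulVec, LinearMap.comp_apply, LinearEquiv.coe_coe,
      LinearEquiv.symm_apply_apply, Matrix.mulVecLin_apply, LSS.prodA, Matrix.one_mul,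
      Matrix.mulVec_mulVec]
  · intro f
    rw [← hZ.gammaEquiv_inVec hOR hrank]
    rfl

theorem isomorphic_of_isColumnSpaceOutput (hZ : Z.IsFactorizationOutput O R)
    (hOR : IsFullRankFactorization O R) (hrank : RankCondition Φ N) {n : ℕ}
    {S : colSpace Φ N ≃ₗ[ℝ] (Fin n → ℝ)} {Z' : Realization Φ n}
    (hZ' : IsColumnSpaceOutput Φ N S Z') : Z.Isomorphic Z' := by
  obtain ⟨hB, hC, hA, hμ⟩ := hZ'
  let T := (gammaEquiv hOR hrank).trans S
  have hT : ∀ (w : Words Q (N + 1)) (j : ColIdx Φ),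
      T (Z.sys.prodA w.1 *ᵥ Z.inVec j) = S (column Φ N w j) := fun w j => by
    rw [← hZ.gammaEquiv_prodA hOR hrank w j]; rfl
  -- The vectors `A_w b_j` with `w` of length at most `N` are the columns of `R` and span `ℝ^r`, so
  -- linear maps need comparing only there.
  have hspan : ∀ {k : ℕ} (f g : (Fin r → ℝ) →ₗ[ℝ] (Fin k → ℝ)), (∀ (w : Words Q N) (j : ColIdx Φ),
      f (Z.sys.prodA w.1 *ᵥ Z.inVec j) = g (Z.sys.prodA w.1 *ᵥ Z.inVec j)) → f = g := by
    intro k f g h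
    refine LinearMap.ext_on hOR.span_col_eq_top ?_
    rintro _ ⟨⟨w, j⟩, rfl⟩
    rw [hZ.col_eq hOR hrank]
    exact h w j
  refine ⟨T, fun q => ?_, fun q => ?_, fun q => ?_, fun f => ?_⟩
  · refine LinearMap.congr_fun (f := (Z'.sys.A q).mulVecLin ∘ₗ T.toLinearMap)
      (g := T.toLinearMap ∘ₗ (Z.sys.A q).mulVecLin) (hspan _ _ fun w j => ?_)
    simp only [LinearMap.comp_apply, LinearEquiv.coe_coe, Matrix.mulVecLin_apply]
    have h := hA q w j
    rw [LinearEquiv.symm_apply_eq, ← hT, ← hT] at h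
    rw [h, Z.sys.prodA_append]
    simp only [LSS.prodA, Matrix.one_mul, Matrix.mulVec_mulVec]
  · refine LinearMap.congr_fun (f := (Z'.sys.B q).mulVecLin)
      (g := T.toLinearMap ∘ₗ (Z.sys.B q).mulVecLin) (LinearMap.pi_ext' fun j =>
        LinearMap.ext_ring ?_)
    simp only [LinearMap.comp_apply, LinearMap.single_apply, LinearEquiv.coe_coe,
      Matrix.mulVecLin_apply, Matrix.mulVec_single_one]
    rw [hB, ← hZ.gammaEquiv_inVec hOR hrank]
    rfl
  · refine LinearMap.congr_fun (f := (Z'.sys.C q).mulVecLin ∘ₗ T.toLinearMap)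
      (g := (Z.sys.C q).mulVecLin) (hspan _ _ fun w j => ?_)
    simp only [LinearMap.comp_apply, LinearEquiv.coe_coe, Matrix.mulVecLin_apply]
    have h := hC q ⟨w.1, w.2.trans (Nat.le_succ N)⟩ j
    rw [← hT] at h
    rw [h, ← hZ.C_prodA hOR hrank]
  · rw [hμ, ← hZ.gammaEquiv_inVec hOR hrank]
    rfl

/-- The left shift of the rows of the Hankel matrix by one letter. -/
def shiftRows (p : ℕ) (q : Q) :
    (List Q × (Q × Fin p) → ℝ) →ₗ[ℝ] (List Q × (Q × Fin p) → ℝ) :=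
  LinearMap.funLeft ℝ ℝ (Prod.map (List.cons q) id)

theorem shiftRows_hankel_col (q : Q) (w : List Q) (j : ColIdx Φ) :
    shiftRows p q ((hankel Φ).col (w, j)) = (hankel Φ).col (w ++ [q], j) := by
  ext ⟨v, q', i⟩
  rw [Matrix.col_apply, hankel_apply, List.append_assoc]
  exact hankel_apply _ _ _ _ _

theorem restrictRows_hankel_col (w : Words Q (N + 1)) (j : ColIdx Φ) :
    restrictRows Q p N ((hankel Φ).col (w.1, j)) = column Φ N w j := by
  ext ⟨v, q, i⟩
  rw [column_coe_apply]
  exact hankel_apply _ _ _ _ _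

/-- Full Hankel columns are recovered from their first `N` layers of rows. The row shift on the full
column space therefore induces an operator on truncated columns, which `Γ̄` conjugates to `A_q`; it
can be iterated along words of any length. -/
theorem isPartialRealization_of_eRank_eq (hZ : Z.IsFactorizationOutput O R)
    (hOR : IsFullRankFactorization O R)
    (hH : (hankelSub Φ N N).eRank = (hankel Φ).eRank) (M : ℕ) : Z.IsPartialRealization M := by
  have hrank := rankCondition_of_eRank_eq hH
  have h1 : (hankelSub Φ N N).eRank = r := hrank.1.trans hOR.2.2.2
  have h2 : (hankel Φ).eRank = r := hH.symm.trans h1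
  set W := Submodule.span ℝ (range (hankel Φ).col)
  have : FiniteDimensional ℝ W := finiteDimensional_of_eRank_eq h2
  have hcol : ∀ w j, (hankel Φ).col (w, j) ∈ W := fun w j => Submodule.subset_span ⟨(w, j), rfl⟩
  -- Truncation maps `W` onto a space containing the columns of `H_{N,N}`; both have dimension `r`,
  -- so its kernel on `W` is zero.
  have hker : ∀ y ∈ W, restrictRows Q p N y = 0 → y = 0 := by
    have hle : Submodule.span ℝ (range (hankelSub Φ N N).col) ≤
        LinearMap.range ((restrictRows Q p N).domRestrict W) := by
      refine Submodule.span_le.2 ?_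
      rintro _ ⟨⟨w, j⟩, rfl⟩
      exact ⟨⟨_, hcol w.1 j⟩, rfl⟩
    have h3 := Submodule.finrank_mono hle
    have h4 := ((restrictRows Q p N).domRestrict W).finrank_range_add_finrank_ker
    rw [finrank_eq_of_eRank_eq h1] at h3
    rw [finrank_eq_of_eRank_eq h2] at h4
    have h5 : LinearMap.ker ((restrictRows Q p N).domRestrict W) = ⊥ :=
      Submodule.finrank_eq_zero.1 (by omega)
    intro y hy h0
    have h6 : (⟨y, hy⟩ : W) ∈ LinearMap.ker ((restrictRows Q p N).domRestrict W) := h0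
    rw [h5, Submodule.mem_bot] at h6
    exact congrArg Subtype.val h6
  have hlift : ∀ x : Fin r → ℝ, ∃ y ∈ W, restrictRows Q p N y = gammaBar O *ᵥ x ∧
      ∀ q, restrictRows Q p N (shiftRows p q y) = gammaBar O *ᵥ (Z.sys.A q *ᵥ x) := by
    intro x
    have hx : x ∈ Submodule.span ℝ (range R.col) := by
      rw [hOR.span_col_eq_top]; exact Submodule.mem_top
    induction hx using Submodule.span_induction with
    | mem x hx =>
      obtain ⟨⟨w, j⟩, rfl⟩ := hx
      refine ⟨_, hcol w.1 j, ?_, fun q => ?_⟩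
      · rw [hOR.gammaBar_mulVec]
        exact restrictRows_hankel_col ⟨w.1, w.2.trans (Nat.le_succ N)⟩ j
      · rw [shiftRows_hankel_col, Matrix.mulVec_mulVec, hZ.gammaBar_mul, hOR.gammaShift_mulVec]
        exact restrictRows_hankel_col ⟨w.1 ++ [q], by simpa using w.2⟩ j
    | zero => exact ⟨0, W.zero_mem, by simp, by simp⟩
    | add x x' _ _ h h' =>
      obtain ⟨y, hy, h1, h2⟩ := h
      obtain ⟨y', hy', h1', h2'⟩ := h'
      exact ⟨y + y', W.add_mem hy hy', by rw [map_add, h1, h1', Matrix.mulVec_add],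
        fun q => by rw [map_add, map_add, h2, h2', Matrix.mulVec_add, Matrix.mulVec_add]⟩
    | smul c x _ h =>
      obtain ⟨y, hy, h1, h2⟩ := h
      exact ⟨c • y, W.smul_mem c hy, by rw [map_smul, h1, Matrix.mulVec_smul],
        fun q => by rw [map_smul, map_smul, h2, Matrix.mulVec_smul, Matrix.mulVec_smul]⟩
  have hrestrict : ∀ (w : List Q) (j : ColIdx Φ), restrictRows Q p N ((hankel Φ).col (w, j)) =
      gammaBar O *ᵥ (Z.sys.prodA w *ᵥ Z.inVec j) := by
    intro w j
    induction w using List.reverseRecOn with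
    | nil =>
      rw [hZ.gammaBar_prodA hOR hrank ⟨[], by simp⟩]
      exact restrictRows_hankel_col ⟨[], by simp⟩ j
    | append_singleton w q ih =>
      obtain ⟨y, hy, h1, h2⟩ := hlift (Z.sys.prodA w *ᵥ Z.inVec j)
      -- The lift `y` has the same truncation as the column `w`, and truncation is injective on `W`,
      -- so its shift is the shift of that column.
      have hyw : y = (hankel Φ).col (w, j) := sub_eq_zero.1
        (hker _ (W.sub_mem hy (hcol w j)) (by rw [map_sub, h1, ih, sub_self]))
      rw [← shiftRows_hankel_col, ← hyw, h2, Z.sys.prodA_append]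
      simp only [LSS.prodA, Matrix.one_mul, Matrix.mulVec_mulVec]
  rw [Z.isPartialRealization_iff]
  intro q w _ j
  ext i
  have h := congrFun (hrestrict w j) (⟨[], by simp⟩, (q, i))
  change hankel Φ ([], (q, i)) (w, j) = O (⟨[], by simp⟩, (q, i)) ⬝ᵥ _ at h
  rw [hankel_apply, List.append_nil, hZ.row_eq] at h
  rw [h, ← Matrix.mulVec_mulVec]
  simp [LSS.prodA, Matrix.mulVec]

end Realization.IsFactorizationOutput

end Factorization

end Algorithms

end LinSwitch

namespace LinSwitch

/-! ### Analytic functionals of switching sequences -/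

section WordFunctionals

variable {Q : Type*} {E : Type*} [NormedAddCommGroup E] [NormedSpace ℝ E]

/-- An analytic function on `[0, ∞)` all of whose derivatives vanish at `0` is zero. -/
theorem eq_zero_of_forall_hasDerivWithinAt [CompleteSpace E] (h : ℕ → ℝ → E)
    (han : AnalyticOn ℝ (h 0) (Ici 0))
    (hder : ∀ n, ∀ s ∈ Ici (0 : ℝ), HasDerivWithinAt (h n) (h (n + 1) s) (Ici 0) s)
    (hzero : ∀ n, h n 0 = 0) : ∀ s ∈ Ici (0 : ℝ), h 0 s = 0 := by
  have hiter : ∀ n, ∀ s ∈ Ici (0 : ℝ), iteratedDerivWithin n (h 0) (Ici 0) s = h n s := by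
    intro n
    induction n with
    | zero => intro s _; simp
    | succ n ih =>
      intro s hs
      rw [iteratedDerivWithin_succ, derivWithin_congr ih (ih s hs),
        (hder n s hs).derivWithin (uniqueDiffOn_Ici 0 s hs)]
  -- The one-sided germ at the endpoint extends to a two-sided analytic `g`, whose derivatives at
  -- `0` are the one-sided ones and hence vanish.
  obtain ⟨g, -, hg, hga⟩ := (han 0 self_mem_Ici).exists_analyticAt
  rw [insert_eq_of_mem self_mem_Ici] at hg
  have hgz : ∀ n, iteratedDeriv n g 0 = 0 := fun n => by
    rw [← iteratedDerivWithin_eq_iteratedDeriv (uniqueDiffOn_Ici 0) hga.contDiffAt self_mem_Ici,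
      ← iteratedDerivWithin_congr hg self_mem_Ici, hiter n 0 self_mem_Ici, hzero]
  have hg0 : g =ᶠ[𝓝 0] 0 := by
    obtain ⟨P, r, hP⟩ := hga
    filter_upwards [Metric.eball_mem_nhds (0 : ℝ) hP.r_pos] with y hy
    have hs := hP.hasSum_iteratedFDeriv hy
    rw [zero_add] at hs
    refine hs.unique ?_
    rw [Pi.zero_apply]
    convert hasSum_zero with n
    rw [iteratedFDeriv_apply_eq_iteratedDeriv_mul_prod, hgz, smul_zero, smul_zero]
  have hIoi : AnalyticOnNhd ℝ (h 0) (Ioi 0) :=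
    isOpen_Ioi.analyticOn_iff_analyticOnNhd.1 (han.mono Ioi_subset_Ici_self)
  obtain ⟨ε, hε, hball⟩ := Metric.eventually_nhds_iff.1 hg0
  -- Identity theorem on the open half-line, started at the interior point `ε / 2`, near which `h 0`
  -- coincides with the vanishing `g`.
  have hpos : EqOn (h 0) 0 (Ioi 0) := by
    refine hIoi.eqOn_zero_of_preconnected_of_eventuallyEq_zero isPreconnected_Ioi
      (z₀ := ε / 2) (half_pos hε) ?_
    filter_upwards [Ioo_mem_nhds (half_pos hε) (half_lt_self hε)] with y hy
    rw [hg hy.1.le]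
    exact hball (by rw [Real.dist_eq, sub_zero, abs_of_pos hy.1]; exact hy.2)
  intro s hs
  rcases eq_or_lt_of_le (mem_Ici.1 hs) with rfl | hs
  · exact hzero 0
  · exact hpos hs

/-- `h ((q₁,t₁)⋯(q_k,t_k))` is analytic in the times, for each word `q₁⋯q_k`. -/
def WordAnalytic (h : List (Q × ℝ≥0) → E) : Prop :=
  ∀ w : List Q, AnalyticOn ℝ (fun t : Fin w.length → ℝ => h (timed w t)) (Ici 0)

/-- Times may be replaced by arbitrary nonnegative analytic functions of a parameter. Freezing some
times and varying others are the special cases used below. -/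
theorem WordAnalytic.comp {h : List (Q × ℝ≥0) → E} (hh : WordAnalytic h) {V : Type*}
    [NormedAddCommGroup V] [NormedSpace ℝ V] {s : Set V} (L : List (Q × (V → ℝ)))
    (hL : ∀ x ∈ L, AnalyticOn ℝ x.2 s ∧ ∀ y ∈ s, 0 ≤ x.2 y) :
    AnalyticOn ℝ (fun y => h (L.map fun x => (x.1, (x.2 y).toNNReal))) s := by
  have h1 : ∀ y, L.map (fun x => (x.1, (x.2 y).toNNReal)) = timed (L.map Prod.fst)
      (fun i => (L[i.1]'(by simpa using i.2)).2 y) := fun y => by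
    apply List.ext_getElem <;> simp [timed]
  simp_rw [h1]
  refine (hh (L.map Prod.fst)).comp (g := fun y i => (L[i.1]'(by simpa using i.2)).2 y)
    (AnalyticOn.pi fun i => (hL _ (List.getElem_mem _)).1) fun y hy i => ?_
  exact (hL _ (List.getElem_mem _)).2 y hy

/-- The derivative at `0` with respect to an additional stay in `b` at the end. -/
noncomputable def wordDeriv (b : Q) (h : List (Q × ℝ≥0) → E) (v : List (Q × ℝ≥0)) : E :=
  derivWithin (fun t : ℝ => h (v ++ [(b, t.toNNReal)])) (Ici 0) 0

/-- Constant-time stays, as input for `WordAnalytic.comp`. -/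
def constTimes (V : Type*) (v : List (Q × ℝ≥0)) : List (Q × (V → ℝ)) :=
  v.map fun x => (x.1, fun _ => x.2)

theorem map_constTimes {V : Type*} (v : List (Q × ℝ≥0)) (y : V) :
    ((constTimes V v).map fun x => (x.1, (x.2 y).toNNReal)) = v := by
  simp [constTimes, Function.comp_def]

theorem constTimes_analyticOn {V : Type*} [NormedAddCommGroup V] [NormedSpace ℝ V] {s : Set V}
    (v : List (Q × ℝ≥0)) :
    ∀ x ∈ constTimes V v, AnalyticOn ℝ x.2 s ∧ ∀ y ∈ s, 0 ≤ x.2 y := by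
  intro x hx
  obtain ⟨a, -, rfl⟩ := List.mem_map.1 hx
  exact ⟨analyticOn_const, fun _ _ => a.2.2⟩

theorem WordAnalytic.append_right {h : List (Q × ℝ≥0) → E} (hh : WordAnalytic h)
    (v : List (Q × ℝ≥0)) : WordAnalytic fun w => h (w ++ v) := by
  intro w
  have h1 := hh.comp (s := Ici (0 : Fin w.length → ℝ))
    ((List.ofFn fun i => (w.get i, fun t : Fin w.length → ℝ => t i)) ++ constTimes _ v) (by
      intro x hx
      rcases List.mem_append.1 hx with hx | hx
      · obtain ⟨i, rfl⟩ := List.mem_ofFn.1 hx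
        exact ⟨(ContinuousLinearMap.proj (R := ℝ) (φ := fun _ => ℝ) i).analyticOn _,
          fun y hy => hy i⟩
      · exact constTimes_analyticOn v x hx)
  simp only [List.map_append, map_constTimes, List.map_ofFn] at h1
  exact h1

theorem WordAnalytic.append_left {h : List (Q × ℝ≥0) → E} (hh : WordAnalytic h)
    (v : List (Q × ℝ≥0)) : WordAnalytic fun w => h (v ++ w) := by
  intro w
  have h1 := hh.comp (s := Ici (0 : Fin w.length → ℝ))
    (constTimes _ v ++ (List.ofFn fun i => (w.get i, fun t : Fin w.length → ℝ => t i))) (by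
      intro x hx
      rcases List.mem_append.1 hx with hx | hx
      · exact constTimes_analyticOn v x hx
      · obtain ⟨i, rfl⟩ := List.mem_ofFn.1 hx
        exact ⟨(ContinuousLinearMap.proj (R := ℝ) (φ := fun _ => ℝ) i).analyticOn _,
          fun y hy => hy i⟩)
  simp only [List.map_append, map_constTimes, List.map_ofFn] at h1
  exact h1

theorem WordAnalytic.analyticOn_append {h : List (Q × ℝ≥0) → E} (hh : WordAnalytic h)
    (v : List (Q × ℝ≥0)) (b : Q) :
    AnalyticOn ℝ (fun t : ℝ => h (v ++ [(b, t.toNNReal)])) (Ici 0) := by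
  have h1 := hh.comp (s := Ici (0 : ℝ)) (constTimes _ v ++ [(b, id)]) (by
      intro x hx
      rcases List.mem_append.1 hx with hx | hx
      · exact constTimes_analyticOn v x hx
      · rw [List.mem_singleton.1 hx]
        exact ⟨analyticOn_id, fun y hy => hy⟩)
  simp only [List.map_append, List.map_cons, List.map_nil, map_constTimes] at h1
  exact h1

theorem WordAnalytic.analyticOn_cons_append {h : List (Q × ℝ≥0) → E} (hh : WordAnalytic h)
    (a : Q) (v : List (Q × ℝ≥0)) (b : Q) :
    AnalyticOn ℝ (fun z : ℝ × ℝ => h ((a, z.1.toNNReal) :: v ++ [(b, z.2.toNNReal)]))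
      (Ici 0) := by
  have h1 := hh.comp (s := Ici (0 : ℝ × ℝ)) ((a, Prod.fst) :: constTimes _ v ++ [(b, Prod.snd)]) (by
      intro x hx
      rcases List.mem_append.1 hx with hx | hx
      · rcases List.mem_cons.1 hx with rfl | hx
        · exact ⟨analyticOn_fst, fun y hy => hy.1⟩
        · exact constTimes_analyticOn v x hx
      · rw [List.mem_singleton.1 hx]
        exact ⟨analyticOn_snd, fun y hy => hy.2⟩)
  simp only [List.map_append, List.map_cons, List.map_nil, map_constTimes] at h1
  exact h1

theorem WordAnalytic.hasDerivWithinAt {h : List (Q × ℝ≥0) → E} (hh : WordAnalytic h)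
    (v : List (Q × ℝ≥0)) (b : Q) :
    HasDerivWithinAt (fun t : ℝ => h (v ++ [(b, t.toNNReal)])) (wordDeriv b h v) (Ici 0) 0 :=
  ((hh.analyticOn_append v b).differentiableOn 0 self_mem_Ici).hasDerivWithinAt

theorem uniqueDiffOn_Ici_pi (ι : Type*) [Finite ι] : UniqueDiffOn ℝ (Ici (0 : ι → ℝ)) := by
  rw [← Set.pi_univ_Ici]
  exact UniqueDiffOn.univ_pi fun _ => uniqueDiffOn_Ici _

theorem derivWithin_snd_eq_fderivWithin {V : Type*} [NormedAddCommGroup V] [NormedSpace ℝ V]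
    {F : V × ℝ → E} {s : Set V} {x : V} {τ : ℝ} (hx : x ∈ s) (hτ : 0 ≤ τ)
    (hF : DifferentiableWithinAt ℝ F (s ×ˢ Ici 0) (x, τ)) :
    derivWithin (fun t => F (x, t)) (Ici 0) τ = fderivWithin ℝ F (s ×ˢ Ici 0) (x, τ) (0, 1) := by
  have h1 : HasDerivWithinAt (fun t : ℝ => (x, t)) ((0 : V), (1 : ℝ)) (Ici 0) τ :=
    (hasDerivWithinAt_const _ _ _).prodMk (hasDerivWithinAt_id _ _)
  exact (hF.hasFDerivWithinAt.comp_hasDerivWithinAt τ h1 fun t ht => ⟨hx, ht⟩).derivWithin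
    (uniqueDiffOn_Ici 0 τ hτ)

/-- The partial derivative is a value of the Fréchet derivative within a product of orthants, which
is again analytic because such a product has unique derivatives, boundary included. -/
theorem WordAnalytic.wordDeriv [CompleteSpace E] {h : List (Q × ℝ≥0) → E} (hh : WordAnalytic h)
    (b : Q) : WordAnalytic (wordDeriv b h) := by
  intro w
  let F : (Fin w.length → ℝ) × ℝ → E := fun z => h (timed w z.1 ++ [(b, z.2.toNNReal)])
  have hF : AnalyticOn ℝ F (Ici 0 ×ˢ Ici 0) := by
    have h1 := hh.comp (s := Ici (0 : Fin w.length → ℝ) ×ˢ Ici (0 : ℝ))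
      ((List.ofFn fun i => (w.get i, fun z : (Fin w.length → ℝ) × ℝ => z.1 i)) ++ [(b, Prod.snd)])
      (by
        intro x hx
        rcases List.mem_append.1 hx with hx | hx
        · obtain ⟨i, rfl⟩ := List.mem_ofFn.1 hx
          exact ⟨((ContinuousLinearMap.proj (R := ℝ) (φ := fun _ => ℝ) i).comp
            (ContinuousLinearMap.fst ℝ (Fin w.length → ℝ) ℝ)).analyticOn _, fun y hy => hy.1 i⟩
        · rw [List.mem_singleton.1 hx]
          exact ⟨analyticOn_snd, fun y hy => hy.2⟩)
    simp only [List.map_append, List.map_cons, List.map_nil, List.map_ofFn] at h1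
    exact h1
  have h2 := hF.fderivWithin ((uniqueDiffOn_Ici_pi (Fin w.length)).prod (uniqueDiffOn_Ici 0))
  have h3 : AnalyticOn ℝ (fun t : Fin w.length → ℝ =>
      fderivWithin ℝ F (Ici 0 ×ˢ Ici 0) (t, 0)) (Ici 0) :=
    h2.comp (g := fun t : Fin w.length → ℝ => (t, (0 : ℝ)))
      (analyticOn_id.prod analyticOn_const) fun t ht => ⟨ht, self_mem_Ici⟩
  have h4 := ((ContinuousLinearMap.apply ℝ E ((0 : Fin w.length → ℝ), (1 : ℝ))).analyticOnNhd
    univ).comp_analyticOn h3 (mapsTo_univ _ _)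
  refine h4.congr fun t ht => ?_
  exact derivWithin_snd_eq_fderivWithin (F := F) ht le_rfl
    (hF.differentiableOn _ ⟨ht, self_mem_Ici⟩)

/-- The mixed derivative at `0` along a word. -/
noncomputable def wordCoeff : List Q → (List (Q × ℝ≥0) → E) → E
  | [], h => h []
  | a :: w, h => derivWithin (fun t : ℝ => wordCoeff w fun v => h ((a, t.toNNReal) :: v)) (Ici 0) 0

theorem mixedDeriv_timed (w : List Q) (h : List (Q × ℝ≥0) → E) :
    mixedDeriv w.length (fun t => h (timed w t)) = wordCoeff w h := by
  induction w generalizing h with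
  | nil => simp [mixedDeriv, wordCoeff, timed]
  | cons a w ih =>
    rw [wordCoeff]
    simp_rw [← ih]
    simp [mixedDeriv, timed, List.ofFn_succ]

/-- Peels off the innermost derivative, whereas the recursive definition exposes the outermost one;
this allows induction on the last letter. -/
theorem wordCoeff_append (w : List Q) (b : Q) (h : List (Q × ℝ≥0) → E) :
    wordCoeff (w ++ [b]) h = wordCoeff w (wordDeriv b h) := by
  induction w generalizing h with
  | nil => rfl
  | cons a w ih =>
    rw [List.cons_append, wordCoeff, wordCoeff]
    simp_rw [ih]
    rfl

/-- Consecutive stays in the same mode can be merged, and stays of length zero be deleted. -/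
structure IsMergeable {α : Type*} (h : List (Q × ℝ≥0) → α) : Prop where
  merge : ∀ (w v : List (Q × ℝ≥0)) (q : Q) (t t' : ℝ≥0),
    h (w ++ (q, t) :: (q, t') :: v) = h (w ++ (q, t + t') :: v)
  delete : ∀ (v w : List (Q × ℝ≥0)) (q : Q), h (v ++ (q, 0) :: w) = h (v ++ w)

theorem IsMergeable.wordDeriv {h : List (Q × ℝ≥0) → E} (hh : IsMergeable h) (b : Q) :
    IsMergeable (wordDeriv b h) where
  merge w v q t t' := by
    simp only [LinSwitch.wordDeriv, List.append_assoc, List.cons_append, hh.merge]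
  delete v w q := by
    simp only [LinSwitch.wordDeriv, List.append_assoc, List.cons_append, hh.delete]

/-- A stay `s` followed by a short stay `δ` in the same mode is a stay `s + δ`, so the derivative at
`s` is a derivative at `0` after a longer past. Iterated `wordDeriv` thus gives the higher
derivatives on all of `[0, ∞)`. -/
theorem IsMergeable.hasDerivWithinAt {h : List (Q × ℝ≥0) → E} (hm : IsMergeable h)
    (ha : WordAnalytic h) (v : List (Q × ℝ≥0)) (a : Q) {s : ℝ} (hs : 0 ≤ s) :
    HasDerivWithinAt (fun t : ℝ => h (v ++ [(a, t.toNNReal)]))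
      (LinSwitch.wordDeriv a h (v ++ [(a, s.toNNReal)])) (Ici 0) s := by
  have h1 := ((ha.analyticOn_append v a).differentiableOn s hs).hasDerivWithinAt
  have h2 : HasDerivWithinAt (fun δ : ℝ => s + δ) 1 (Ici 0) 0 :=
    (hasDerivWithinAt_id _ _).const_add s
  have h3 := HasDerivWithinAt.scomp_of_eq (0 : ℝ) h1 h2
    (fun δ (hδ : 0 ≤ δ) => add_nonneg hs hδ) (by simp)
  rw [one_smul] at h3
  have h4 : LinSwitch.wordDeriv a h (v ++ [(a, s.toNNReal)]) =
      derivWithin (fun t : ℝ => h (v ++ [(a, t.toNNReal)])) (Ici 0) s := by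
    refine HasDerivWithinAt.derivWithin (h3.congr_of_mem (fun δ hδ => ?_) self_mem_Ici)
      (uniqueDiffOn_Ici 0 0 self_mem_Ici)
    simp only [List.append_assoc, List.cons_append, List.nil_append, hm.merge, Function.comp_apply]
    rw [Real.toNNReal_add hs hδ]
  rw [h4]
  exact h1

/-- Mergeable analytic functionals are determined by their mixed derivatives at `0`. -/
theorem eq_of_wordCoeff_eq [CompleteSpace E] {h g : List (Q × ℝ≥0) → E} (hm : IsMergeable h)
    (ha : WordAnalytic h) (gm : IsMergeable g) (ga : WordAnalytic g)
    (hhg : ∀ w, wordCoeff w h = wordCoeff w g) (v : List (Q × ℝ≥0)) : h v = g v := by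
  induction v using List.reverseRecOn generalizing h g with
  | nil => exact hhg []
  | append_singleton v x ih =>
    obtain ⟨a, s⟩ := x
    let D : (List (Q × ℝ≥0) → E) → ℕ → List (Q × ℝ≥0) → E := fun f n => (wordDeriv a)^[n] f
    have hD : ∀ (f : List (Q × ℝ≥0) → E) n, D f (n + 1) = wordDeriv a (D f n) := fun f n =>
      Function.iterate_succ_apply' _ _ _
    have hDm : ∀ {f : List (Q × ℝ≥0) → E}, IsMergeable f → ∀ n, IsMergeable (D f n) :=
      fun hf n => by
        induction n with
        | zero => exact hf
        | succ n ih => rw [hD]; exact ih.wordDeriv a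
    have hDa : ∀ {f : List (Q × ℝ≥0) → E}, WordAnalytic f → ∀ n, WordAnalytic (D f n) :=
      fun hf n => by
        induction n with
        | zero => exact hf
        | succ n ih => rw [hD]; exact ih.wordDeriv a
    have hDc : ∀ n w, wordCoeff w (D h n) = wordCoeff w (D g n) := fun n => by
      induction n with
      | zero => exact hhg
      | succ n ih => intro w; rw [hD, hD, ← wordCoeff_append, ← wordCoeff_append, ih]
    -- As a function of the last time, the difference has the iterates of `wordDeriv` as
    -- derivatives. At time `0` the last stay is deleted, and the induction hypothesis for the
    -- shorter list applies to each iterate.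
    have key := eq_zero_of_forall_hasDerivWithinAt
      (fun n t => D h n (v ++ [(a, t.toNNReal)]) - D g n (v ++ [(a, t.toNNReal)]))
      ((ha.analyticOn_append v a).sub (ga.analyticOn_append v a))
      (fun n t ht => by
        rw [hD, hD]
        exact ((hDm hm n).hasDerivWithinAt (hDa ha n) v a ht).sub
          ((hDm gm n).hasDerivWithinAt (hDa ga n) v a ht))
      (fun n => by
        rw [Real.toNNReal_zero, (hDm hm n).delete, (hDm gm n).delete, List.append_nil, sub_eq_zero]
        exact ih (hDm hm n) (hDa ha n) (hDm gm n) (hDa ga n) (hDc n)) s s.2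
    rw [Real.toNNReal_coe] at key
    exact sub_eq_zero.1 key

end WordFunctionals

end LinSwitch

namespace LinSwitch

/-! ### Mixed derivatives of integrals -/

section WordCoefficients

variable {Q : Type*} {E : Type*} [NormedAddCommGroup E] [NormedSpace ℝ E]

/-- `h` has the mixed derivative `c` along a word. -/
def HasWordCoeff : List Q → (List (Q × ℝ≥0) → E) → E → Prop
  | [], h, c => h [] = c
  | a :: w, h, c => ∃ φ : ℝ → E,
      (∀ t, 0 ≤ t → HasWordCoeff w (fun v => h ((a, t.toNNReal) :: v)) (φ t)) ∧
        HasDerivWithinAt φ c (Ici 0) 0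

/-- The relation records differentiability at every stage. For `wordCoeff` alone additivity can
fail, since `derivWithin` is zero where no derivative exists. -/
theorem HasWordCoeff.add {w : List Q} {h g : List (Q × ℝ≥0) → E} {c d : E}
    (hh : HasWordCoeff w h c) (hg : HasWordCoeff w g d) :
    HasWordCoeff w (fun v => h v + g v) (c + d) := by
  induction w generalizing h g c d with
  | nil => exact congrArg₂ (· + ·) hh hg
  | cons a w ih =>
    obtain ⟨φ, h1, h2⟩ := hh
    obtain ⟨ψ, g1, g2⟩ := hg
    exact ⟨fun t => φ t + ψ t, fun t ht => ih (h1 t ht) (g1 t ht), h2.add g2⟩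

theorem HasWordCoeff.wordCoeff_eq {w : List Q} {h : List (Q × ℝ≥0) → E} {c : E}
    (hh : HasWordCoeff w h c) : wordCoeff w h = c := by
  induction w generalizing h c with
  | nil => exact hh
  | cons a w ih =>
    obtain ⟨φ, h1, h2⟩ := hh
    exact (h2.congr_of_mem (fun t ht => ih (h1 t ht)) self_mem_Ici).derivWithin
      (uniqueDiffOn_Ici 0 0 self_mem_Ici)

theorem HasWordCoeff.append_singleton {w : List Q} {b : Q} {h h' : List (Q × ℝ≥0) → E} {c : E}
    (hd : ∀ v, HasDerivWithinAt (fun t : ℝ => h (v ++ [(b, t.toNNReal)])) (h' v) (Ici 0) 0)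
    (hh : HasWordCoeff w h' c) : HasWordCoeff (w ++ [b]) h c := by
  induction w generalizing h h' c with
  | nil =>
    have h0 : h' [] = c := hh
    exact ⟨fun t => h [(b, t.toNNReal)], fun t _ => rfl, h0 ▸ hd []⟩
  | cons a w ih =>
    obtain ⟨φ, h1, h2⟩ := hh
    exact ⟨φ, fun t ht => ih (fun v => hd (_ :: v)) (h1 t ht), h2⟩

theorem WordAnalytic.hasWordCoeff [CompleteSpace E] {h : List (Q × ℝ≥0) → E}
    (hh : WordAnalytic h) (w : List Q) : HasWordCoeff w h (wordCoeff w h) := by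
  induction w using List.reverseRecOn generalizing h with
  | nil => rfl
  | append_singleton w b ih =>
    rw [wordCoeff_append]
    exact HasWordCoeff.append_singleton (fun v => hh.hasDerivWithinAt v b) (ih (hh.wordDeriv b))

/-- The coefficient along `w` depends analytically on the time of a preceding stay. -/
theorem WordAnalytic.analyticOn_wordCoeff [CompleteSpace E] {h : List (Q × ℝ≥0) → E}
    (hh : WordAnalytic h) (a : Q) (w : List Q) :
    AnalyticOn ℝ (fun s : ℝ => wordCoeff w fun v => h ((a, s.toNNReal) :: v)) (Ici 0) := by
  induction w using List.reverseRecOn generalizing h with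
  | nil => exact hh.analyticOn_append [] a
  | append_singleton w b ih =>
    simp_rw [wordCoeff_append]
    exact ih (hh.wordDeriv b)

/-- One-sided differentiation under the integral sign. -/
theorem hasDerivWithinAt_integral_of_analyticOn [CompleteSpace E] {F : ℝ × ℝ → E}
    (hF : AnalyticOn ℝ F (Ici 0)) {t : ℝ} (ht : 0 ≤ t) :
    HasDerivWithinAt (fun τ => ∫ s in (0 : ℝ)..t, F (s, τ))
      (∫ s in (0 : ℝ)..t, derivWithin (fun τ => F (s, τ)) (Ici 0) 0) (Ici 0) 0 := by
  rw [show (Ici (0 : ℝ × ℝ)) = Ici 0 ×ˢ Ici 0 from (Ici_prod_Ici _ _).symm] at hF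
  have hud : UniqueDiffOn ℝ (Ici (0 : ℝ) ×ˢ Ici (0 : ℝ)) :=
    (uniqueDiffOn_Ici 0).prod (uniqueDiffOn_Ici 0)
  have hder : ∀ s ∈ Ici (0 : ℝ), ∀ τ ∈ Ici (0 : ℝ), HasDerivWithinAt (fun τ => F (s, τ))
      (fderivWithin ℝ F (Ici 0 ×ˢ Ici 0) (s, τ) (0, 1)) (Ici 0) τ := fun s hs τ hτ => by
    have h1 : HasDerivWithinAt (fun t : ℝ => (s, t)) ((0 : ℝ), (1 : ℝ)) (Ici 0) τ :=
      (hasDerivWithinAt_const _ _ _).prodMk (hasDerivWithinAt_id _ _)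
    exact (hF.differentiableOn _ ⟨hs, hτ⟩).hasFDerivWithinAt.comp_hasDerivWithinAt τ h1
      fun t ht => ⟨hs, ht⟩
  have hcont : ContinuousOn (fun z => fderivWithin ℝ F (Ici 0 ×ˢ Ici 0) z (0, 1))
      (Ici (0 : ℝ) ×ˢ Ici (0 : ℝ)) :=
    (hF.fderivWithin hud).continuousOn.clm_apply continuousOn_const
  obtain ⟨M, hM⟩ := (isCompact_Icc (a := (0 : ℝ)) (b := t)).prod
    (isCompact_Icc (a := (0 : ℝ)) (b := 1)) |>.exists_bound_of_continuousOn
    (hcont.mono (prod_mono Icc_subset_Ici_self Icc_subset_Ici_self))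
  have hslice : ∀ τ, 0 ≤ τ → ContinuousOn (fun s => F (s, τ)) (uIcc 0 t) := fun τ hτ => by
    rw [uIcc_of_le ht]
    exact hF.continuousOn.comp (by fun_prop) fun s hs => ⟨hs.1, hτ⟩
  rw [hasDerivWithinAt_iff_tendsto_slope]
  have hIoi : Ici (0 : ℝ) \ {0} = Ioi 0 := by ext x; simp [lt_iff_le_and_ne, eq_comm]
  rw [hIoi]
  -- Dominated convergence for the difference quotients: the mean value inequality on `[0, 1]`
  -- bounds them by the maximum `M` of the partial derivative on a compact rectangle.
  have hlim : Tendsto (fun τ => ∫ s in (0 : ℝ)..t, slope (fun τ => F (s, τ)) 0 τ) (𝓝[>] 0)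
      (𝓝 (∫ s in (0 : ℝ)..t, derivWithin (fun τ => F (s, τ)) (Ici 0) 0)) := by
    refine intervalIntegral.tendsto_integral_filter_of_dominated_convergence (fun _ => M) ?_ ?_
      intervalIntegrable_const ?_
    · filter_upwards [self_mem_nhdsWithin] with τ hτ
      have hc : ContinuousOn (fun s => slope (fun τ => F (s, τ)) 0 τ) (uIcc 0 t) := by
        simp only [slope, vsub_eq_sub]
        exact ((hslice τ (le_of_lt hτ)).sub (hslice 0 le_rfl)).const_smul _
      exact (intervalIntegrable_iff.1 hc.intervalIntegrable).aestronglyMeasurable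
    · filter_upwards [Ioo_mem_nhdsGT (zero_lt_one' ℝ)] with τ hτ
      refine MeasureTheory.ae_of_all _ fun s hs => ?_
      rw [uIoc_of_le ht] at hs
      have hb := (convex_Icc (0 : ℝ) 1).norm_image_sub_le_of_norm_hasDerivWithin_le
        (f := fun τ => F (s, τ)) (C := M)
        (fun x hx => (hder s hs.1.le x hx.1).mono Icc_subset_Ici_self)
        (fun x hx => hM (s, x) ⟨⟨hs.1.le, hs.2⟩, hx⟩) (left_mem_Icc.2 zero_le_one)
        ⟨hτ.1.le, hτ.2.le⟩
      rw [slope, vsub_eq_sub, norm_smul, norm_inv, ← div_eq_inv_mul]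
      rw [sub_zero] at hb ⊢
      exact (div_le_iff₀ (norm_pos_iff.2 hτ.1.ne')).2 hb
    · refine MeasureTheory.ae_of_all _ fun s hs => ?_
      rw [uIoc_of_le ht] at hs
      have h1 := hder s hs.1.le 0 self_mem_Ici
      rw [h1.derivWithin (uniqueDiffOn_Ici 0 0 self_mem_Ici)]
      rw [hasDerivWithinAt_iff_tendsto_slope, hIoi] at h1
      exact h1
  refine hlim.congr' ?_
  filter_upwards [self_mem_nhdsWithin] with τ hτ
  simp only [slope, vsub_eq_sub]
  rw [intervalIntegral.integral_smul, intervalIntegral.integral_sub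
    (hslice τ (le_of_lt hτ)).intervalIntegrable (hslice 0 le_rfl).intervalIntegrable]

theorem WordAnalytic.hasWordCoeff_integral [CompleteSpace E] {h : List (Q × ℝ≥0) → E}
    (hh : WordAnalytic h) (a : Q) (w : List Q) {t : ℝ} (ht : 0 ≤ t) :
    HasWordCoeff w (fun v => ∫ s in (0 : ℝ)..t, h ((a, s.toNNReal) :: v))
      (∫ s in (0 : ℝ)..t, wordCoeff w fun v => h ((a, s.toNNReal) :: v)) := by
  induction w using List.reverseRecOn generalizing h with
  | nil => rfl
  | append_singleton w b ih =>
    simp_rw [wordCoeff_append]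
    refine HasWordCoeff.append_singleton (fun v => ?_) (ih (hh.wordDeriv b))
    exact hasDerivWithinAt_integral_of_analyticOn (hh.analyticOn_cons_append a v b) ht

end WordCoefficients

/-! ### Markov parameters in terms of the kernels -/

section Kernels

variable {Q : Type*} {m p : ℕ}

/-- The contribution of the input `u`, fed in from time `τ` on, to the output. -/
noncomputable def kernelInt (G : List (Q × ℝ≥0) → Matrix (Fin p) (Fin m) ℝ)
    (u : ℝ≥0 → (Fin m → ℝ)) : ℝ≥0 → List (Q × ℝ≥0) → (Fin p → ℝ)
  | _, [] => 0
  | τ, (q, t) :: w => (∫ s in (0 : ℝ)..t,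
      G ((q, ((t : ℝ) - s).toNNReal) :: w) *ᵥ u (s.toNNReal + τ)) + kernelInt G u (τ + t) w

theorem sum_integral_eq_kernelInt (G : List (Q × ℝ≥0) → Matrix (Fin p) (Fin m) ℝ)
    (u : ℝ≥0 → (Fin m → ℝ)) (τ : ℝ≥0) (w : List (Q × ℝ≥0)) :
    ∑ i : Fin w.length, ∫ s in (0 : ℝ)..((w.get i).2 : ℝ),
        G (((w.get i).1, (((w.get i).2 : ℝ) - s).toNNReal) :: w.drop (i + 1)) *ᵥ
          u (s.toNNReal + (τ + ((w.take i).map Prod.snd).sum)) = kernelInt G u τ w := by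
  induction w generalizing τ with
  | nil => simp [kernelInt]
  | cons x w ih =>
    obtain ⟨q, t⟩ := x
    rw [kernelInt, ← ih]
    refine (Fin.sum_univ_succ (n := w.length) _).trans ?_
    simp [add_assoc]

/-- `f` has the kernels `K` and `G`, which are analytic on words followed by a mode at time `0`. -/
structure HasKernels (f : IOMap Q m p) (K : List (Q × ℝ≥0) → (Fin p → ℝ))
    (G : List (Q × ℝ≥0) → Matrix (Fin p) (Fin m) ℝ) : Prop where
  analytic_init : ∀ q, WordAnalytic fun v => K (v ++ [(q, 0)])
  analytic_input : ∀ q e, WordAnalytic fun v => G (v ++ [(q, 0)]) *ᵥ e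
  apply_eq : ∀ u w, f u w = K w.1 + kernelInt G u.1 0 w.1

theorem hasDerivWithinAt_integral_Ici {E : Type*} [NormedAddCommGroup E] [NormedSpace ℝ E]
    [CompleteSpace E] {g : ℝ → E} (hg : ContinuousOn g (Ici 0)) :
    HasDerivWithinAt (fun t => ∫ s in (0 : ℝ)..t, g s) (g 0) (Ici 0) 0 := by
  have hc : Continuous fun s : ℝ => g (max s 0) :=
    hg.comp_continuous (by fun_prop) fun s => le_max_right s 0
  have h1 := (hc.integral_hasStrictDerivAt 0 0).hasDerivAt.hasDerivWithinAt (s := Ici 0)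
  rw [max_self] at h1
  refine h1.congr_of_mem (fun t (ht : 0 ≤ t) => ?_) self_mem_Ici
  refine intervalIntegral.integral_congr fun s hs => ?_
  rw [uIcc_of_le ht] at hs
  simp only [max_eq_left hs.1]

/-- For a constant input the contributions of the later stays have a coefficient independent of the
starting time. The derivative in the first time therefore kills them and leaves only the first
integrand at zero. -/
theorem hasWordCoeff_kernelInt {G : List (Q × ℝ≥0) → Matrix (Fin p) (Fin m) ℝ} {q : Q}
    {e : Fin m → ℝ} (hG : WordAnalytic fun v => G (v ++ [(q, 0)]) *ᵥ e) (w : List Q) :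
    ∃ c, (∀ τ, HasWordCoeff w (fun v => kernelInt G (fun _ => e) τ (v ++ [(q, 0)])) c) ∧
      ∀ a w', w = a :: w' → c = wordCoeff w' fun v => G ((a, 0) :: v ++ [(q, 0)]) *ᵥ e := by
  induction w with
  | nil =>
    refine ⟨0, fun τ => ?_, by simp⟩
    simp [HasWordCoeff, kernelInt]
  | cons a w ih =>
    obtain ⟨c, hc, -⟩ := ih
    have hcont := (hG.analyticOn_wordCoeff a w).continuousOn
    refine ⟨_, fun τ => ⟨fun t => (∫ s in (0 : ℝ)..t,
      wordCoeff w fun v => G ((a, s.toNNReal) :: v ++ [(q, 0)]) *ᵥ e) + c, fun t ht => ?_,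
      (hasDerivWithinAt_integral_Ici hcont).add_const c⟩, ?_⟩
    · have h1 := (hG.hasWordCoeff_integral a w ht).add (hc (τ + t.toNNReal))
      convert h1 using 2 with v
      simp only [List.cons_append, kernelInt]
      congr 1
      rw [Real.coe_toNNReal t ht]
      -- The substitution `s ↦ t - s` is harmless for a constant input and makes the kernel argument
      -- independent of the upper limit.
      have h2 := intervalIntegral.integral_comp_sub_left (a := 0) (b := t)
        (fun s => G ((a, s.toNNReal) :: (v ++ [(q, 0)])) *ᵥ e) t
      rw [h2, sub_self, sub_zero]
    · rintro a' w' h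
      obtain ⟨rfl, rfl⟩ := List.cons.inj h
      simp

theorem mixedDeriv_alongWord (f : IOMap Q m p) (u : PC m) (w : List Q) (q : Q) :
    mixedDeriv w.length (alongWord f u w q) =
      wordCoeff w fun v => f u ⟨v ++ [(q, 0)], by simp⟩ :=
  mixedDeriv_timed w fun v => f u ⟨v ++ [(q, 0)], by simp⟩

namespace HasKernels

variable {f : IOMap Q m p} {K : List (Q × ℝ≥0) → (Fin p → ℝ)}
  {G : List (Q × ℝ≥0) → Matrix (Fin p) (Fin m) ℝ}

theorem kernelInt_zero (τ : ℝ≥0) (w : List (Q × ℝ≥0)) :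
    kernelInt G (fun _ => 0) τ w = 0 := by
  induction w generalizing τ with
  | nil => rfl
  | cons x w ih => simp [kernelInt, ih]

theorem markovInit_eq (h : HasKernels f K G) (q : Q) (w : List Q) :
    markovInit f q w = wordCoeff w fun v => K (v ++ [(q, 0)]) := by
  rw [markovInit, mixedDeriv_alongWord]
  congr 1
  ext1 v
  exact (h.apply_eq _ _).trans ((congrArg _ (kernelInt_zero 0 _)).trans (add_zero _))

theorem markovInputOf_eq (h : HasKernels f K G) (q q₀ : Q) (j : Fin m) (w : List Q) :
    markovInputOf f q q₀ j w =
      wordCoeff w fun v => G ((q₀, 0) :: v ++ [(q, 0)]) *ᵥ Pi.single j 1 := by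
  obtain ⟨c, hc, hc'⟩ := hasWordCoeff_kernelInt (h.analytic_input q (Pi.single j 1)) (q₀ :: w)
  have h1 := (((h.analytic_init q).hasWordCoeff (q₀ :: w)).add (hc 0)).wordCoeff_eq
  rw [markovInputOf, mixedDeriv_alongWord, sub_eq_iff_eq_add', ← hc' q₀ w rfl]
  have h2 := h.markovInit_eq q (q₀ :: w)
  rw [markovInit] at h2
  rw [h2, ← h1]
  congr 1
  ext1 v
  exact h.apply_eq _ _

end HasKernels

end Kernels

end LinSwitch

namespace LinSwitch

/-! ### Flows of linear switched systems -/

section Flow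

variable {Q : Type*} {n m p : ℕ}

/-- The matrix `A_q` as an operator. -/
noncomputable def LSS.opA (sys : LSS Q n m p) (q : Q) : (Fin n → ℝ) →L[ℝ] (Fin n → ℝ) :=
  (sys.A q).mulVecLin.toContinuousLinearMap

/-- The matrix `B_q` as an operator. -/
noncomputable def LSS.opB (sys : LSS Q n m p) (q : Q) : (Fin m → ℝ) →L[ℝ] (Fin n → ℝ) :=
  (sys.B q).mulVecLin.toContinuousLinearMap

/-- The matrix `C_q` as an operator. -/
noncomputable def LSS.opC (sys : LSS Q n m p) (q : Q) : (Fin n → ℝ) →L[ℝ] (Fin p → ℝ) :=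
  (sys.C q).mulVecLin.toContinuousLinearMap

/-- The autonomous flow `e^{t A_q}`. -/
noncomputable def LSS.flow (sys : LSS Q n m p) (q : Q) (t : ℝ) :
    (Fin n → ℝ) →L[ℝ] (Fin n → ℝ) :=
  NormedSpace.exp (t • sys.opA q)

/-- The autonomous flow along a switching sequence. -/
noncomputable def LSS.trans (sys : LSS Q n m p) :
    List (Q × ℝ≥0) → ((Fin n → ℝ) →L[ℝ] (Fin n → ℝ))
  | [] => 1
  | (q, t) :: w => sys.trans w * sys.flow q t

variable (sys : LSS Q n m p)

theorem LSS.flow_zero (q : Q) : sys.flow q 0 = 1 := by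
  rw [LSS.flow, zero_smul, NormedSpace.exp_zero]

theorem LSS.flow_add (q : Q) (s t : ℝ) : sys.flow q (s + t) = sys.flow q s * sys.flow q t := by
  rw [LSS.flow, LSS.flow, LSS.flow, add_smul]
  let _ := NormedAlgebra.restrictScalars ℚ ℝ ((Fin n → ℝ) →L[ℝ] (Fin n → ℝ))
  exact NormedSpace.exp_add_of_commute
    (((Commute.refl (sys.opA q)).smul_left s).smul_right t)

theorem LSS.hasDerivAt_flow (q : Q) (t : ℝ) :
    HasDerivAt (sys.flow q) (sys.opA q * sys.flow q t) t :=
  hasDerivAt_exp_smul_const' (sys.opA q) t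

theorem LSS.continuous_flow (q : Q) : Continuous (sys.flow q) :=
  continuous_iff_continuousAt.2 fun t => (sys.hasDerivAt_flow q t).continuousAt

theorem LSS.commute_flow (q : Q) (t : ℝ) : sys.opA q * sys.flow q t = sys.flow q t * sys.opA q :=
  (hasDerivAt_exp_smul_const' (sys.opA q) t).unique (hasDerivAt_exp_smul_const (sys.opA q) t)

theorem LSS.analyticOn_flow (q : Q) (s : Set ℝ) : AnalyticOn ℝ (sys.flow q) s := by
  intro t _
  have h1 : AnalyticAt ℝ (fun t : ℝ => t • sys.opA q) t := by fun_prop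
  exact (AnalyticAt.comp (f := fun t : ℝ => t • sys.opA q)
    (NormedSpace.exp_analytic (𝕂 := ℝ) (t • sys.opA q)) h1).analyticWithinAt

theorem LSS.trans_append (w v : List (Q × ℝ≥0)) :
    sys.trans (w ++ v) = sys.trans v * sys.trans w := by
  induction w with
  | nil => simp [LSS.trans]
  | cons x w ih => obtain ⟨q, t⟩ := x; simp [LSS.trans, ih, mul_assoc]

theorem LSS.trans_append_zero (v : List (Q × ℝ≥0)) (q : Q) :
    sys.trans (v ++ [(q, 0)]) = sys.trans v := by
  simp [LSS.trans_append, LSS.trans, LSS.flow_zero]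

theorem timed_cons (a : Q) (w : List Q) (t : Fin (w.length + 1) → ℝ) :
    timed (a :: w) t = (a, (t 0).toNNReal) :: timed w (fun i => t i.succ) := by
  simp [timed, List.ofFn_succ]

theorem LSS.wordAnalytic_trans : WordAnalytic sys.trans := by
  intro w
  induction w with
  | nil => exact analyticOn_const
  | cons a w ih =>
    have h1 : AnalyticOn ℝ (fun t : Fin (w.length + 1) → ℝ =>
        sys.trans (timed w fun i => t i.succ)) (Ici 0) :=
      ih.comp (g := fun t : Fin (w.length + 1) → ℝ => fun i : Fin w.length => t i.succ)
        (AnalyticOn.pi fun i =>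
          (ContinuousLinearMap.proj (R := ℝ) (φ := fun _ => ℝ) i.succ).analyticOn _)
        fun t ht i => ht i.succ
    have h2 : AnalyticOn ℝ (fun t : Fin (w.length + 1) → ℝ => sys.flow a (t 0)) (Ici 0) :=
      (sys.analyticOn_flow a univ).comp (g := fun t : Fin (w.length + 1) → ℝ => t 0)
        ((ContinuousLinearMap.proj (R := ℝ) (φ := fun _ : Fin (w.length + 1) => ℝ) 0).analyticOn _)
        (mapsTo_univ _ _)
    refine (h1.mul h2).congr fun t ht => ?_
    rw [timed_cons, LSS.trans, Real.coe_toNNReal _ (ht 0)]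

theorem LSS.wordAnalytic_apply {E : Type*} [NormedAddCommGroup E] [NormedSpace ℝ E]
    (L : (Fin n → ℝ) →L[ℝ] E) (x : Fin n → ℝ) : WordAnalytic fun v => L (sys.trans v x) :=
  fun w => ((L.comp (ContinuousLinearMap.apply ℝ (Fin n → ℝ) x)).analyticOnNhd
    univ).comp_analyticOn (sys.wordAnalytic_trans w) (mapsTo_univ _ _)

theorem LSS.isMergeable_trans : IsMergeable sys.trans where
  merge w v q t t' := by
    simp only [LSS.trans_append, LSS.trans, mul_assoc, NNReal.coe_add]
    rw [add_comm (t : ℝ), LSS.flow_add]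
    simp only [mul_assoc]
  delete v w q := by
    simp only [LSS.trans_append, LSS.trans, NNReal.coe_zero, LSS.flow_zero, mul_one]

theorem LSS.isMergeable_apply {E : Type*} [NormedAddCommGroup E] [NormedSpace ℝ E]
    (L : (Fin n → ℝ) →L[ℝ] E) (x : Fin n → ℝ) : IsMergeable fun v => L (sys.trans v x) where
  merge w v q t t' := by rw [sys.isMergeable_trans.merge]
  delete v w q := by rw [sys.isMergeable_trans.delete]

theorem LSS.wordDeriv_apply {E : Type*} [NormedAddCommGroup E] [NormedSpace ℝ E]
    (L : (Fin n → ℝ) →L[ℝ] E) (x : Fin n → ℝ) (b : Q) :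
    wordDeriv b (fun v => L (sys.trans v x)) = fun v => (L ∘L sys.opA b) (sys.trans v x) := by
  ext1 v
  have h1 : HasDerivWithinAt (fun t : ℝ => L (sys.flow b t (sys.trans v x)))
      ((L ∘L sys.opA b) (sys.trans v x)) (Ici 0) 0 := by
    have h2 := L.hasFDerivAt.comp_hasDerivAt (0 : ℝ)
      ((sys.hasDerivAt_flow b 0).clm_apply (hasDerivAt_const (0 : ℝ) (sys.trans v x)))
    simp only [LSS.flow_zero, mul_one, map_zero, add_zero] at h2
    exact h2.hasDerivWithinAt
  refine HasDerivWithinAt.derivWithin (h1.congr_of_mem (fun t (ht : 0 ≤ t) => ?_) self_mem_Ici)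
    (uniqueDiffOn_Ici 0 0 self_mem_Ici)
  simp [LSS.trans_append, LSS.trans, ht]

/-- Differentiating a final stay in `b` at time `0` replaces the output map `L` by `L A_b`, so the
word builds up the matrix product. -/
theorem LSS.wordCoeff_apply {E : Type*} [NormedAddCommGroup E] [NormedSpace ℝ E]
    (L : (Fin n → ℝ) →L[ℝ] E) (x : Fin n → ℝ) (w : List Q) :
    wordCoeff w (fun v => L (sys.trans v x)) = L (sys.prodA w *ᵥ x) := by
  induction w using List.reverseRecOn generalizing L with
  | nil => simp [wordCoeff, LSS.trans, LSS.prodA]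
  | append_singleton w b ih =>
    rw [wordCoeff_append, LSS.wordDeriv_apply, ih, LSS.prodA_append, ← Matrix.mulVec_mulVec]
    simp [LSS.prodA, LSS.opA]

end Flow

/-! ### Variation of constants -/

section Solutions

variable {Q : Type*} {n m p : ℕ}

/-- One-sided limits together with the value at the point give local boundedness; compactness of
`[0, T]` does the rest. -/
theorem PC.exists_bound (u : PC m) (T : ℝ≥0) : ∃ M, ∀ r ≤ T, ‖u.1 r‖ ≤ M := by
  have hloc : ∀ r : ℝ≥0, ∃ M, ∀ᶠ y in 𝓝 r, ‖u.1 y‖ ≤ M := by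
    intro r
    have hlim : ∀ {l : Filter ℝ≥0} {a : Fin m → ℝ}, Tendsto u.1 l (𝓝 a) →
        ∀ᶠ y in l, ‖u.1 y‖ ≤ ‖a‖ + 1 := fun h =>
      (h.norm.eventually (gt_mem_nhds (lt_add_one _))).mono fun _ h => le_of_lt h
    by_cases hc : ContinuousAt u.1 r
    · exact ⟨_, hlim hc⟩
    · obtain ⟨⟨a, ha⟩, ⟨b, hb⟩⟩ := u.2.2 r hc
      refine ⟨max (‖u.1 r‖) (max (‖a‖ + 1) (‖b‖ + 1)), ?_⟩
      rw [← nhdsNE_sup_pure, ← nhdsLT_sup_nhdsGT]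
      refine eventually_sup.2 ⟨eventually_sup.2 ⟨(hlim ha).mono fun y hy => ?_,
        (hlim hb).mono fun y hy => ?_⟩, ?_⟩
      · exact hy.trans ((le_max_left _ _).trans (le_max_right _ _))
      · exact hy.trans ((le_max_right _ _).trans (le_max_right _ _))
      · exact eventually_pure.2 (le_max_left _ _)
  have hcomp := (isCompact_Icc (a := (0 : ℝ≥0)) (b := T)).induction_on
    (p := fun s => ∃ M, ∀ r ∈ s, ‖u.1 r‖ ≤ M) ⟨0, by simp⟩
    (fun s t hst ⟨M, hM⟩ => ⟨M, fun r hr => hM r (hst hr)⟩)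
    (fun s t ⟨M, hM⟩ ⟨M', hM'⟩ => ⟨max M M', fun r hr => hr.elim
      (fun h => (hM r h).trans (le_max_left _ _)) fun h => (hM' r h).trans (le_max_right _ _)⟩)
    (fun r _ => by
      obtain ⟨M, hM⟩ := hloc r
      exact ⟨_, mem_nhdsWithin_of_mem_nhds hM, M, fun _ h => h⟩)
  obtain ⟨M, hM⟩ := hcomp
  exact ⟨M, fun r hr => hM r ⟨zero_le, hr⟩⟩

theorem PC.finite_discontinuities (u : PC m) (τ : ℝ≥0) (t : ℝ) :
    {s : ℝ | s ∈ Ioo 0 t ∧ ¬ ContinuousAt (fun s : ℝ => u.1 (s.toNNReal + τ)) s}.Finite := by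
  refine Set.Finite.of_finite_image (f := fun s : ℝ => s.toNNReal + τ)
    ((u.2.1 (t.toNNReal + τ)).subset ?_) ?_
  · rintro _ ⟨s, ⟨hs, hc⟩, rfl⟩
    refine ⟨add_le_add_left (Real.toNNReal_le_toNNReal hs.2.le) τ, fun h => hc ?_⟩
    exact ContinuousAt.comp (f := fun s : ℝ => s.toNNReal + τ) h (by fun_prop)
  · rintro s ⟨hs, -⟩ s' ⟨hs', -⟩ h
    exact (Real.toNNReal_eq_toNNReal_iff hs.1.le hs'.1.le).1 (add_right_cancel h)

theorem intervalIntegrable_of_bounded {E : Type*} [NormedAddCommGroup E] {g : ℝ → E} {t : ℝ}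
    (ht : 0 ≤ t) {F : Set ℝ} (hF : F.Finite) (hg : ∀ s ∈ Ioo 0 t \ F, ContinuousAt g s) {M : ℝ}
    (hM : ∀ s ∈ Ioo 0 t, ‖g s‖ ≤ M) : IntervalIntegrable g MeasureTheory.volume 0 t := by
  rw [intervalIntegrable_iff_integrableOn_Ioo_of_le ht]
  have hmeas : MeasureTheory.AEStronglyMeasurable g
      (MeasureTheory.volume.restrict (Ioo 0 t)) := by
    have h1 : ContinuousOn g (Ioo 0 t \ F) := fun s hs => (hg s hs).continuousWithinAt
    have h2 := h1.aestronglyMeasurable (μ := MeasureTheory.volume)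
      (measurableSet_Ioo.diff hF.measurableSet)
    rwa [MeasureTheory.Measure.restrict_congr_set
      (MeasureTheory.sdiff_null_ae_eq_self (hF.measure_zero _))] at h2
  refine MeasureTheory.IntegrableOn.of_bound (by simp) hmeas M ?_
  exact (MeasureTheory.ae_restrict_iff' measurableSet_Ioo).2 (MeasureTheory.ae_of_all _ hM)

variable (sys : LSS Q n m p)

theorem LSS.intervalIntegrable_flow (q : Q) (u : PC m) (τ : ℝ≥0) {t : ℝ} (ht : 0 ≤ t)
    {θ : ℝ → ℝ} (hθ : Continuous θ) :
    IntervalIntegrable (fun s => sys.flow q (θ s) (sys.opB q (u.1 (s.toNNReal + τ))))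
      MeasureTheory.volume 0 t := by
  obtain ⟨M, hM⟩ := u.exists_bound (t.toNNReal + τ)
  have hc : Continuous fun s => sys.flow q (θ s) ∘L sys.opB q :=
    ((sys.continuous_flow q).comp hθ).clm_comp continuous_const
  obtain ⟨M', hM'⟩ := (isCompact_Icc (a := (0 : ℝ)) (b := t)).exists_bound_of_continuousOn
    hc.continuousOn
  refine intervalIntegrable_of_bounded ht (u.finite_discontinuities τ t) (M := M' * M) ?_ ?_
  · rintro s ⟨hs, hsF⟩
    have h1 : ContinuousAt (fun s : ℝ => u.1 (s.toNNReal + τ)) s := by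
      by_contra h
      exact hsF ⟨hs, h⟩
    exact hc.continuousAt.clm_apply h1
  · intro s hs
    refine ((sys.flow q (θ s) ∘L sys.opB q).le_opNorm _).trans ?_
    exact mul_le_mul (hM' s ⟨hs.1.le, hs.2.le⟩)
      (hM _ (add_le_add_left (Real.toNNReal_le_toNNReal hs.2.le) τ)) (norm_nonneg _)
      ((norm_nonneg _).trans (hM' s ⟨hs.1.le, hs.2.le⟩))

/-- The state after a stay of length `t` in mode `q`. -/
noncomputable def LSS.step (q : Q) (u : PC m) (τ : ℝ≥0) (t : ℝ) (x : Fin n → ℝ) : Fin n → ℝ :=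
  sys.flow q t x + ∫ s in (0 : ℝ)..t, sys.flow q (t - s) (sys.opB q (u.1 (s.toNNReal + τ)))

/-- Variation of constants: `e^{(t-s)A} ξ(s)` has derivative `e^{(t-s)A} B u(s)` off finitely many
times, and the fundamental theorem tolerates a countable exceptional set. This also gives uniqueness
of the final state. -/
theorem LSS.eq_step_of_isSolution {q : Q} {u : PC m} {τ : ℝ≥0} {t : ℝ} (ht : 0 ≤ t)
    {ξ : ℝ → Fin n → ℝ}
    (hξ : IsSolution (sys.A q) (sys.B q) (fun s => u.1 (s.toNNReal + τ)) t ξ) :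
    ξ t = sys.step q u τ t (ξ 0) := by
  have hcont : ContinuousOn (fun s => sys.flow q (t - s) (ξ s)) (Icc 0 t) :=
    ((sys.continuous_flow q).comp (continuous_const.sub continuous_id)).continuousOn.clm_apply hξ.1
  have h := MeasureTheory.integral_eq_of_hasDerivAt_off_countable_of_le
    (fun s => sys.flow q (t - s) (ξ s))
    (fun s => sys.flow q (t - s) (sys.opB q (u.1 (s.toNNReal + τ)))) ht
    (u.finite_discontinuities τ t).countable hcont ?_
    (sys.intervalIntegrable_flow q u τ ht (continuous_const.sub continuous_id))
  · simp only [sub_self, sub_zero, LSS.flow_zero, one_apply_eq_self] at h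
    rw [LSS.step, h]
    simp
  · rintro s ⟨hs, hsF⟩
    have hc : ContinuousAt (fun s : ℝ => u.1 (s.toNNReal + τ)) s := by
      by_contra h
      exact hsF ⟨hs, h⟩
    have h1 := hξ.2 s hs hc
    have h2 : HasDerivAt (fun s => sys.flow q (t - s)) (-(sys.opA q * sys.flow q (t - s))) s := by
      have := (sys.hasDerivAt_flow q (t - s)).scomp s ((hasDerivAt_id s).const_sub t)
      simp only [neg_smul, one_smul] at this
      exact this
    have h3 := h2.clm_apply h1
    convert h3 using 1
    rw [sys.commute_flow]
    simp [LSS.opA, LSS.opB]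

theorem LSS.exists_isSolution (q : Q) (u : PC m) (τ : ℝ≥0) {t : ℝ} (ht : 0 ≤ t)
    (x : Fin n → ℝ) : ∃ ξ : ℝ → Fin n → ℝ, ξ 0 = x ∧
      IsSolution (sys.A q) (sys.B q) (fun s => u.1 (s.toNNReal + τ)) t ξ := by
  let g : ℝ → Fin n → ℝ := fun s => sys.flow q (-s) (sys.opB q (u.1 (s.toNNReal + τ)))
  have hg : ∀ {r : ℝ}, 0 ≤ r → IntervalIntegrable g MeasureTheory.volume 0 r := fun hr =>
    sys.intervalIntegrable_flow q u τ hr continuous_neg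
  -- Pulling the flow out of the integral leaves an integrand independent of `r`, so the product
  -- rule applies directly.
  refine ⟨fun r => sys.flow q r (x + ∫ s in (0 : ℝ)..r, g s), ?_, ?_, ?_⟩
  · simp [LSS.flow_zero]
  · refine (sys.continuous_flow q).continuousOn.clm_apply (continuousOn_const.add ?_)
    have h1 := intervalIntegral.continuousOn_primitive_interval (μ := MeasureTheory.volume)
      (f := g) (a := 0) (b := t) ?_
    · rwa [uIcc_of_le ht] at h1
    · rw [uIcc_of_le ht, integrableOn_Icc_iff_integrableOn_Ioc]
      exact (intervalIntegrable_iff_integrableOn_Ioc_of_le ht).1 (hg ht)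
  · intro s hs hc
    have hgc : ContinuousAt g s :=
      ((sys.continuous_flow q).comp continuous_neg).continuousAt.clm_apply
        ((sys.opB q).continuous.continuousAt.comp hc)
    have h1 : HasDerivAt (fun r => ∫ s in (0 : ℝ)..r, g s) (g s) s :=
      intervalIntegral.integral_hasDerivAt_right (hg hs.1.le)
        ⟨Ioo 0 t, Ioo_mem_nhds hs.1 hs.2,
          ((intervalIntegrable_iff_integrableOn_Ioo_of_le ht).1 (hg ht)).aestronglyMeasurable⟩ hgc
    have h2 := (sys.hasDerivAt_flow q s).clm_apply (h1.const_add x)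
    refine h2.congr_deriv (congrArg₂ (· + ·) rfl ?_)
    change (sys.flow q s * sys.flow q (-s)) (sys.opB q (u.1 (s.toNNReal + τ))) = _
    rw [← LSS.flow_add, add_neg_cancel, LSS.flow_zero]
    rfl

/-- The state reached from `x` along a switching sequence. -/
noncomputable def LSS.stateMap (u : PC m) : ℝ≥0 → (Fin n → ℝ) → List (Q × ℝ≥0) → (Fin n → ℝ)
  | _, x, [] => x
  | τ, x, (q, t) :: w => LSS.stateMap u (τ + t) (sys.step q u τ t x) w

theorem LSS.isState_iff (u : PC m) (τ : ℝ≥0) (x₀ : Fin n → ℝ) (w : List (Q × ℝ≥0))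
    (x : Fin n → ℝ) : sys.IsState u τ x₀ w x ↔ x = sys.stateMap u τ x₀ w := by
  induction w generalizing τ x₀ with
  | nil => rfl
  | cons y w ih =>
    obtain ⟨q, t⟩ := y
    simp only [LSS.IsState, LSS.stateMap, ih]
    constructor
    · rintro ⟨ξ, rfl, hξ, rfl⟩
      rw [sys.eq_step_of_isSolution t.coe_nonneg hξ]
    · rintro rfl
      obtain ⟨ξ, rfl, hξ⟩ := sys.exists_isSolution q u τ t.coe_nonneg x₀
      exact ⟨ξ, rfl, hξ, by rw [sys.eq_step_of_isSolution t.coe_nonneg hξ]⟩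

/-- The output operator of the last mode of a switching sequence. -/
noncomputable def LSS.lastC (l : List (Q × ℝ≥0)) : (Fin n → ℝ) →L[ℝ] (Fin p → ℝ) :=
  match l.getLast? with
  | none => 0
  | some x => sys.opC x.1

/-- The input kernel of a linear switched system. -/
noncomputable def LSS.kernelG (l : List (Q × ℝ≥0)) : Matrix (Fin p) (Fin m) ℝ :=
  match l with
  | [] => 0
  | (q, t) :: v => LinearMap.toMatrix'
      ((sys.lastC ((q, t) :: v) ∘L sys.trans ((q, t) :: v) ∘L sys.opB q : _ →L[ℝ] _) :
        (Fin m → ℝ) →ₗ[ℝ] (Fin p → ℝ))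

theorem LSS.kernelG_cons_mulVec (q : Q) (t : ℝ≥0) (v : List (Q × ℝ≥0)) (e : Fin m → ℝ) :
    sys.kernelG ((q, t) :: v) *ᵥ e =
      sys.lastC ((q, t) :: v) (sys.trans ((q, t) :: v) (sys.opB q e)) := by
  rw [LSS.kernelG, LinearMap.toMatrix'_mulVec]
  rfl

theorem LSS.lastC_append (v : List (Q × ℝ≥0)) (q : Q) (t : ℝ≥0) :
    sys.lastC (v ++ [(q, t)]) = sys.opC q := by
  simp [LSS.lastC]

theorem LSS.lastC_cons (x : Q × ℝ≥0) {v : List (Q × ℝ≥0)} (hv : v ≠ []) :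
    sys.lastC (x :: v) = sys.lastC v := by
  obtain ⟨y, v, rfl⟩ := List.exists_cons_of_ne_nil hv
  simp [LSS.lastC, List.getLast?_cons_cons]

theorem LSS.lastC_eq_getLast {v : List (Q × ℝ≥0)} (hv : v ≠ []) :
    sys.lastC v = sys.opC (v.getLast hv).1 := by
  simp [LSS.lastC, List.getLast?_eq_getLast_of_ne_nil hv]

theorem LSS.apply_trans_step {E : Type*} [NormedAddCommGroup E] [NormedSpace ℝ E]
    [CompleteSpace E] (L : (Fin n → ℝ) →L[ℝ] E) (q : Q) (u : PC m) (τ t : ℝ≥0) (x : Fin n → ℝ)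
    (w : List (Q × ℝ≥0)) :
    L (sys.trans w (sys.step q u τ t x)) = L (sys.trans ((q, t) :: w) x) +
      ∫ s in (0 : ℝ)..t, L (sys.trans ((q, ((t : ℝ) - s).toNNReal) :: w)
        (sys.opB q (u.1 (s.toNNReal + τ)))) := by
  rw [LSS.step, map_add, map_add]
  congr 1
  have h1 := (L ∘L sys.trans w).intervalIntegral_comp_comm
    (sys.intervalIntegrable_flow q u τ t.coe_nonneg (θ := fun s => t - s) (by fun_prop))
  refine Eq.trans h1.symm (intervalIntegral.integral_congr fun s hs => ?_)
  rw [uIcc_of_le t.coe_nonneg] at hs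
  simp only [LSS.trans, Real.coe_toNNReal _ (sub_nonneg.2 hs.2)]
  rfl

/-- Superposition: each stay adds an integral that the remaining autonomous flow carries to the end.
The output of a system is thereby put into kernel form. -/
theorem LSS.lastC_stateMap (u : PC m) (τ : ℝ≥0) (x : Fin n → ℝ) {w : List (Q × ℝ≥0)}
    (hw : w ≠ []) : sys.lastC w (sys.stateMap u τ x w) =
      sys.lastC w (sys.trans w x) + kernelInt sys.kernelG u.1 τ w := by
  induction w generalizing τ x with
  | nil => exact absurd rfl hw
  | cons y w ih =>
    obtain ⟨q, t⟩ := y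
    have hlast : ∀ t', sys.lastC ((q, t') :: w) = sys.lastC ((q, t) :: w) := fun t' => by
      rcases eq_or_ne w [] with rfl | h
      · rfl
      · rw [LSS.lastC_cons _ _ h, LSS.lastC_cons _ _ h]
    simp only [LSS.stateMap, kernelInt, LSS.kernelG_cons_mulVec, hlast]
    rw [← add_assoc, ← sys.apply_trans_step]
    rcases eq_or_ne w [] with rfl | h
    · simp [LSS.stateMap, LSS.trans, kernelInt]
    · rw [LSS.lastC_cons _ _ h, ih _ _ h]

theorem LSS.isOutput_iff (x : Fin n → ℝ) (u : PC m) (w : SwitchSeq Q) (y : Fin p → ℝ) :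
    sys.IsOutput x u w y ↔
      y = sys.lastC w.1 (sys.trans w.1 x) + kernelInt sys.kernelG u.1 0 w.1 := by
  rw [← sys.lastC_stateMap u 0 x w.2, sys.lastC_eq_getLast w.2]
  simp only [LSS.IsOutput, LSS.isState_iff, exists_eq_left]
  rfl

theorem LSS.kernelG_append_mulVec (q₀ q : Q) (t : ℝ≥0) (v : List (Q × ℝ≥0)) (e : Fin m → ℝ) :
    sys.kernelG ((q₀, t) :: v ++ [(q, 0)]) *ᵥ e =
      sys.opC q (sys.trans ((q₀, t) :: v) (sys.opB q₀ e)) := by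
  rw [List.cons_append, LSS.kernelG_cons_mulVec, ← List.cons_append, LSS.lastC_append,
    LSS.trans_append_zero]

theorem LSS.hasKernels {f : IOMap Q m p} {x : Fin n → ℝ}
    (hf : ∀ u w, sys.IsOutput x u w (f u w)) :
    HasKernels f (fun v => sys.lastC v (sys.trans v x)) sys.kernelG where
  analytic_init q := by
    simp only [LSS.lastC_append, LSS.trans_append_zero]
    exact sys.wordAnalytic_apply _ x
  analytic_input q e := by
    rintro (_ | ⟨a, w⟩)
    · exact analyticOn_const (𝕜 := ℝ) (v := sys.kernelG [(q, 0)] *ᵥ e)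
    · refine (sys.wordAnalytic_apply (sys.opC q) (sys.opB a e) (a :: w)).congr fun t _ => ?_
      simp only [timed_cons]
      exact sys.kernelG_append_mulVec _ _ _ _ _
  apply_eq u w := (sys.isOutput_iff x u w _).1 (hf u w)

end Solutions

end LinSwitch

namespace LinSwitch

/-! ### Realizations and Markov parameters -/

section RealizationMarkov

variable {Q : Type*} {m p n : ℕ} {Φ : Set (IOMap Q m p)}

/-- For nonempty `Φ` the given realization itself works. For empty `Φ` the input Markov parameters
are zero by convention while `B` is arbitrary, so `B` is replaced by `0` in the same dimension. -/
theorem Realization.exists_isPartialRealization {Z : Realization Φ n} (hZ : Z.IsRealization) :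
    ∃ Z' : Realization Φ n, ∀ M, Z'.IsPartialRealization M := by
  rcases Φ.eq_empty_or_nonempty with rfl | hne
  · refine ⟨⟨⟨Z.sys.A, 0, Z.sys.C⟩, Z.μ⟩, fun M q w _ => ⟨fun q₀ j => ?_, fun f => f.2.elim⟩⟩
    simp only [markovInput, Set.not_nonempty_empty, dite_false, Pi.zero_apply, Matrix.mul_zero,
      Matrix.zero_mulVec]
  · refine ⟨Z, fun M q w _ => ⟨fun q₀ j => ?_, fun f => ?_⟩⟩
    · have hk := Z.sys.hasKernels (hZ ⟨_, hne.some_mem⟩)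
      rw [markovInput, dif_pos hne, hk.markovInputOf_eq]
      simp_rw [LSS.kernelG_append_mulVec, LSS.trans, NNReal.coe_zero, LSS.flow_zero, mul_one]
      rw [LSS.wordCoeff_apply]
      simp only [LSS.opC, LSS.opB, LinearMap.coe_toContinuousLinearMap', Matrix.mulVecLin_apply,
        Matrix.mulVec_mulVec, Matrix.mul_assoc]
    · have hk := Z.sys.hasKernels (hZ f)
      rw [hk.markovInit_eq]
      simp_rw [LSS.lastC_append, LSS.trans_append_zero]
      rw [LSS.wordCoeff_apply]
      simp [LSS.opC, Matrix.mulVec_mulVec]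

theorem wordAnalytic_append_singleton {E : Type*} [NormedAddCommGroup E] [NormedSpace ℝ E]
    {h : List (Q × ℝ≥0) → E} (hh : ∀ w : List Q, w ≠ [] →
      AnalyticOn ℝ (fun t : Fin w.length → ℝ => h (timed w t)) (Ici 0)) (x : Q × ℝ≥0) :
    WordAnalytic fun v => h (v ++ [x]) := by
  classical
  -- Nothing is known about `h` on the empty list; resetting that value does not affect lists ending
  -- in `x`.
  have h1 : WordAnalytic fun v => if v = [] then 0 else h v := by
    rintro (_ | ⟨a, w⟩)
    · exact analyticOn_const (𝕜 := ℝ) (v := (0 : E))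
    · refine (hh (a :: w) (by simp)).congr fun t _ => ?_
      simp only [timed_cons, reduceCtorEq, if_false]
  simpa using h1.append_right [x]

theorem kernelInt_congr {G G' : List (Q × ℝ≥0) → Matrix (Fin p) (Fin m) ℝ}
    (h : ∀ l, l ≠ [] → G l = G' l) (u : ℝ≥0 → (Fin m → ℝ)) (τ : ℝ≥0) (w : List (Q × ℝ≥0)) :
    kernelInt G u τ w = kernelInt G' u τ w := by
  induction w generalizing τ with
  | nil => rfl
  | cons x w ih =>
    obtain ⟨q, t⟩ := x
    simp only [kernelInt, ih]
    simp_rw [h (_ :: _) (by simp)]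

/-- The kernels of `Φ` and those of the system have equal mixed derivatives, so they coincide on
nonempty lists, and the kernels determine the outputs. -/
theorem Realization.isRealization_of_isPartialRealization (hΦ : HasKernelRepresentation Φ)
    {Z : Realization Φ n} (hZ : ∀ M, Z.IsPartialRealization M) : Z.IsRealization := by
  obtain ⟨K, G, hKan, hGan, hKm, hGm, hKd, hGd, hf⟩ := hΦ
  intro f u w
  have hk : ∀ f : Φ, HasKernels f.1 (K f) G := fun f =>
    { analytic_init := fun q => wordAnalytic_append_singleton (hKan f) _
      analytic_input := fun q e => wordAnalytic_append_singleton (h := fun l => G l *ᵥ e)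
        (fun w hw => AnalyticOn.pi fun i => by
          simp only [Matrix.mulVec, dotProduct]
          exact Finset.analyticOn_fun_sum _ fun j _ => (hGan w hw i j).mul analyticOn_const) _
      apply_eq := fun u w => by
        rw [hf f u w, ← sum_integral_eq_kernelInt]
        simp only [zero_add] }
  have hΦne : Φ.Nonempty := ⟨f.1, f.2⟩
  have hK : ∀ (q : Q) v, K f (v ++ [(q, 0)]) = Z.sys.opC q (Z.sys.trans v (Z.μ f)) := by
    intro q
    refine eq_of_wordCoeff_eq ⟨fun w v a t t' => ?_, fun v w a => ?_⟩ ((hk f).analytic_init q)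
      (Z.sys.isMergeable_apply _ _) (Z.sys.wordAnalytic_apply _ _) fun w => ?_
    · simpa using hKm f w (v ++ [(q, 0)]) a t t'
    · simpa using hKd f v (w ++ [(q, 0)]) a (by simp)
    · rw [← (hk f).markovInit_eq, LSS.wordCoeff_apply, (hZ w.length q w le_rfl).2 f]
      simp [LSS.opC, Matrix.mulVec_mulVec]
  -- The first mode of `G` selects the input matrix and may not be deleted. Freezing it as `(q₀, 0)`
  -- makes the dependence on the rest mergeable, including deletion at the front of `v`.
  have hG : ∀ (q q₀ : Q) (j : Fin m) v, G ((q₀, 0) :: v ++ [(q, 0)]) *ᵥ Pi.single j 1 =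
      Z.sys.opC q (Z.sys.trans v (Z.sys.opB q₀ (Pi.single j 1))) := by
    intro q q₀ j
    refine eq_of_wordCoeff_eq ⟨fun w v a t t' => ?_, fun v w a => ?_⟩
      (((hk f).analytic_input q (Pi.single j 1)).append_left [(q₀, 0)])
      (Z.sys.isMergeable_apply _ _) (Z.sys.wordAnalytic_apply _ _) fun w => ?_
    · have := hGm ((q₀, 0) :: w) (v ++ [(q, 0)]) a t t'
      simp only [List.cons_append, List.append_assoc] at this ⊢
      rw [this]
    · have := hGd ((q₀, 0) :: v) (w ++ [(q, 0)]) a (by simp) (by simp)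
      simp only [List.cons_append, List.append_assoc] at this ⊢
      rw [this]
    · have h1 := (hZ w.length q w le_rfl).1 q₀ j
      rw [markovInput, dif_pos hΦne,
        HasKernels.markovInputOf_eq (hk ⟨_, hΦne.some_mem⟩)] at h1
      rw [h1, LSS.wordCoeff_apply]
      simp only [LSS.opC, LSS.opB, LinearMap.coe_toContinuousLinearMap', Matrix.mulVecLin_apply,
        Matrix.mulVec_mulVec, Matrix.mul_assoc]
  have hKall : ∀ l, l ≠ [] → K f l = Z.sys.lastC l (Z.sys.trans l (Z.μ f)) := by
    intro l hl
    obtain ⟨v, ⟨q, t⟩, rfl⟩ := List.eq_nil_or_concat' l |>.resolve_left hl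
    have h1 := hKm f v [] q t 0
    rw [add_zero] at h1
    rw [← h1, LSS.lastC_append, ← hK]
    simp
  have hGall : ∀ l, l ≠ [] → G l = Z.sys.kernelG l := by
    intro l hl
    obtain ⟨v, ⟨q, t⟩, hv⟩ := List.eq_nil_or_concat' l |>.resolve_left hl
    obtain ⟨⟨q₀, t₀⟩, v', hv'⟩ := List.exists_cons_of_ne_nil hl
    have h1 : G (l ++ [(q, 0)]) = G l := by
      have := hGm v [] q t 0
      rw [add_zero] at this
      rw [hv, ← this]
      simp
    -- The artificial initial stay is merged into the first stay of `l`, which is in the same mode,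
    -- since deletion is not allowed at the front.
    have h2 : G ((q₀, 0) :: l ++ [(q, 0)]) = G (l ++ [(q, 0)]) := by
      have := hGm [] (v' ++ [(q, 0)]) q₀ 0 t₀
      rw [zero_add] at this
      rw [hv']
      exact this
    refine Matrix.ext_of_mulVec_single fun j => ?_
    rw [← h1, ← h2, hG]
    have hlast : Z.sys.lastC l = Z.sys.opC q := by rw [hv, LSS.lastC_append]
    rw [hv'] at hlast ⊢
    rw [LSS.kernelG_cons_mulVec, hlast]
  rw [LSS.isOutput_iff, (hk f).apply_eq, hKall _ w.2, kernelInt_congr hGall]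

theorem Realization.IsFactorizationOutput.isMinimalRealization {N r : ℕ}
    {O : Matrix (Words Q (N + 1) × (Q × Fin p)) (Fin r) ℝ}
    {R : Matrix (Fin r) (Words Q N × ColIdx Φ) ℝ} {Z : Realization Φ r}
    (hZ : Z.IsFactorizationOutput O R) (hΦ : HasKernelRepresentation Φ)
    (hOR : IsFullRankFactorization O R)
    (hH : (hankelSub Φ N N).eRank = (hankel Φ).eRank) : Z.IsMinimalRealization := by
  refine ⟨Realization.isRealization_of_isPartialRealization hΦ
    (hZ.isPartialRealization_of_eRank_eq hOR hH), fun k Z' hZ' => ?_⟩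
  obtain ⟨Z₁, hZ₁⟩ := Realization.exists_isPartialRealization hZ'
  have h1 := Realization.eRank_hankel_le hZ₁
  rw [← hH, (rankCondition_of_eRank_eq hH).1, hOR.2.2.2] at h1
  exact_mod_cast h1

end RealizationMarkov

/-! ### Finiteness of the row indices and assembly of the theorem -/

theorem finite_words (Q : Type*) [Finite Q] (L : ℕ) : Finite (Words Q L) :=
  (List.finite_length_le Q L).to_subtype

end LinSwitch

theorem theorem3 {Q : Type*} [Finite Q] {m p : ℕ} (Φ : Set (LinSwitch.IOMap Q m p))
    (hΦ : LinSwitch.HasKernelRepresentation Φ) (N : ℕ) (hN : 0 < N) :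
    -- both algorithms can be started
    (∃ (r : ℕ) (O : Matrix (LinSwitch.Words Q (N + 1) × (Q × Fin p)) (Fin r) ℝ)
      (R : Matrix (Fin r) (LinSwitch.Words Q N × LinSwitch.ColIdx Φ) ℝ),
      LinSwitch.IsFullRankFactorization O R) ∧
    (∃ n : ℕ, Nonempty (LinSwitch.colSpace Φ N ≃ₗ[ℝ] (Fin n → ℝ))) ∧
    -- partial realization
    (LinSwitch.RankCondition Φ N →
      ∀ (r : ℕ) (O : Matrix (LinSwitch.Words Q (N + 1) × (Q × Fin p)) (Fin r) ℝ)
        (R : Matrix (Fin r) (LinSwitch.Words Q N × LinSwitch.ColIdx Φ) ℝ),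
        LinSwitch.IsFullRankFactorization O R →
        ∃ Z : LinSwitch.Realization Φ r,
          LinSwitch.factorizationAlgorithm O R = some Z ∧
          Z.IsMinimalPartialRealization (2 * N + 1) ∧
          ∀ (n : ℕ) (S : LinSwitch.colSpace Φ N ≃ₗ[ℝ] (Fin n → ℝ)),
            (∃ Z' : LinSwitch.Realization Φ n, LinSwitch.IsColumnSpaceOutput Φ N S Z') ∧
            ∀ Z' : LinSwitch.Realization Φ n, LinSwitch.IsColumnSpaceOutput Φ N S Z' →
              Z.Isomorphic Z') ∧
    -- complete realization
    ((LinSwitch.hankelSub Φ N N).eRank = (LinSwitch.hankel Φ).eRank →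
      LinSwitch.RankCondition Φ N ∧
      ∀ (r : ℕ) (O : Matrix (LinSwitch.Words Q (N + 1) × (Q × Fin p)) (Fin r) ℝ)
        (R : Matrix (Fin r) (LinSwitch.Words Q N × LinSwitch.ColIdx Φ) ℝ),
        LinSwitch.IsFullRankFactorization O R →
        ∃ Z : LinSwitch.Realization Φ r,
          LinSwitch.factorizationAlgorithm O R = some Z ∧ Z.IsMinimalRealization) ∧
    -- a realization of dimension at most `N + 1` exists
    ((∃ (n : ℕ) (Z₀ : LinSwitch.Realization Φ n), n ≤ N + 1 ∧ Z₀.IsRealization) →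
      (LinSwitch.hankelSub Φ N N).eRank = (LinSwitch.hankel Φ).eRank ∧
      ∀ (r : ℕ) (O : Matrix (LinSwitch.Words Q (N + 1) × (Q × Fin p)) (Fin r) ℝ)
        (R : Matrix (Fin r) (LinSwitch.Words Q N × LinSwitch.ColIdx Φ) ℝ),
        LinSwitch.IsFullRankFactorization O R →
        ∃ Z : LinSwitch.Realization Φ r,
          LinSwitch.factorizationAlgorithm O R = some Z ∧ Z.IsMinimalRealization) := by
  -- Finitely many rows make the column spaces finite-dimensional although `Φ`, and with it the set
  -- of columns, may be infinite.
  have := LinSwitch.finite_words Q N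
  have := LinSwitch.finite_words Q (N + 1)
  have hcomplete : (LinSwitch.hankelSub Φ N N).eRank = (LinSwitch.hankel Φ).eRank →
      ∀ (r : ℕ) (O : Matrix (LinSwitch.Words Q (N + 1) × (Q × Fin p)) (Fin r) ℝ)
        (R : Matrix (Fin r) (LinSwitch.Words Q N × LinSwitch.ColIdx Φ) ℝ),
        LinSwitch.IsFullRankFactorization O R →
        ∃ Z : LinSwitch.Realization Φ r,
          LinSwitch.factorizationAlgorithm O R = some Z ∧ Z.IsMinimalRealization := by
    intro hH r O R hOR
    obtain ⟨Z, hZ, hZ'⟩ := hOR.exists_output (LinSwitch.rankCondition_of_eRank_eq hH)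
    exact ⟨Z, hZ, hZ'.isMinimalRealization hΦ hOR hH⟩
  refine ⟨LinSwitch.exists_fullRank_factorization _,
    ⟨_, ⟨(Module.finBasis ℝ (LinSwitch.colSpace Φ N)).equivFun⟩⟩, fun hrank r O R hOR => ?_,
    fun hH => ⟨LinSwitch.rankCondition_of_eRank_eq hH, hcomplete hH⟩, ?_⟩
  · obtain ⟨Z, hZ, hZ'⟩ := hOR.exists_output hrank
    exact ⟨Z, hZ, hZ'.isMinimalPartialRealization hOR hrank, fun n S =>
      ⟨hZ'.exists_isColumnSpaceOutput hOR hrank S,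
        fun _ h => hZ'.isomorphic_of_isColumnSpaceOutput hOR hrank h⟩⟩
  · rintro ⟨n, Z₀, hn, hZ₀⟩
    obtain ⟨Z₁, hZ₁⟩ := LinSwitch.Realization.exists_isPartialRealization hZ₀
    have hH := LinSwitch.eRank_hankelSub_eq_of_isPartialRealization hZ₁ hn
    exact ⟨hH, hcomplete hH⟩
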